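/- Let $(W,S)$ be a finite Coxeter system and let $c_s$ ($s\in S$) be positive integers with $c_s=c_{s'}$ whenever $s,s'$ are conjugate in $W$ (the parameters are otherwise arbitrary). Let $\mathcal Z=\mathbb Z[t,t^{-1}]$ and let $\mathcal H$ be the generic Hecke algebra over $\mathcal Z$: the $\mathcal Z$-algebra with basis $T_w$ ($w\in W$), $T_1=1$, and $T_sT_w=T_{sw}$ if $sw>w$, $T_sT_w=t^{2c_s}T_{sw}+(t^{2c_s}-1)T_w$ if $sw<w$. Let $(C'_w)_{w\in W}$ be its Kazhdan–Lusztig basis: with $L(w)=c_{s_1}+\dots+c_{s_k}$ for a reduced expression $w=s_1\cdots s_k$, $C'_w$ is the unique element that is fixed by the bar involution $\sum_w a_wT_w\mapsto\sum_w\overline{a_w}\,T_{w^{-1}}^{-1}$ (where $\overline{t}=t^{-1}$) and congruent to $t^{-L(w)}T_w$ modulo $\sum_{y}t^{-1}\mathbb Z[t^{-1}]\,t^{-L(y)}T_y$. Let $\leq_L$ be the left preorder on $W$, i.e. the preorder generated by $z\leq_L y$ whenever $C'_z$ occurs with nonzero coefficient in $C'_xC'_y$ for some $x\in W$; its equivalence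 classes are the left cells. For a left cell $\omega$ let $S(\omega)=\mathcal H^{\leq_L\omega}/\mathcal H^{<_L\omega}$ be the left cell module, where $\mathcal H^{\leq_L\omega}$ (resp. $\mathcal H^{<_L\omega}$) is the left ideal of $\mathcal H$ spanned over $\mathcal Z$ by the $C'_y$ with $y\leq_L\omega$ (resp. $y<_L\omega$). For a commutative $\mathcal Z$-algebra $R$ put $\mathcal H_R=\mathcal H\otimes_{\mathcal Z}R$, let $q\in R$ be the image of $t^2$, and let $S_{\omega,R}=\operatorname{Hom}_R(S(\omega)\otimes_{\mathcal Z}R,\,R)$ be the dual left cell module, a right $\mathcal H_R$-module. For $\lambda\subseteq S$ let $W_\lambda=\langle s: s\in\lambda\rangle$, let $x_\lambda=\sum_{w\in W_\lambda}T_w\in\mathcal H_R$, and let $x_\lambda\mathcal H_R$ be the right ideal it generates. Let $R$ be a commutative domain with fraction field $F$ that is also a $\mathcal Z$-algebra, and let $\lambda\subseteq S$. Assume that (1) $\mathcal H_F$ is semisimple, and (2) $q^{c_s}+1$ is invertible in $R$ for each $s\in\lambda$. Then for every left cell $\omega$, $$\operatorname{Ext}^1_{\mathcal H_R}(S_{\omega,R},\,x_\lambda\mathcal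 H_R)=0,$$ where $\operatorname{Ext}^1$ is taken in the category of right $\mathcal H_R$-modules. -/

import Mathlib

namespace HeckeCell

section Coxeter

variable {B W : Type*} [Group W] {M : CoxeterMatrix B} (cs : CoxeterSystem M W)

open CoxeterSystem
open scoped Classical in
/-- The involution of `W × ZMod 2` attached to a simple reflection, used to count inversions. -/
noncomputable def invPerm (i : B) (p : W × ZMod 2) : W × ZMod 2 :=
  (cs.simple i * p.1 * cs.simple i, p.2 + if p.1 = cs.simple i then 1 else 0)

open scoped Classical in
theorem invPerm_iterate (i j : B) (k : ℕ) (p : W × ZMod 2) :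
    ((invPerm cs i ∘ invPerm cs j)^[k] p) =
      ((cs.simple i * cs.simple j) ^ k * p.1 * ((cs.simple i * cs.simple j) ^ k)⁻¹,
        p.2 + ∑ n ∈ Finset.range (2 * k),
          if p.1 = ((cs.simple i * cs.simple j) ^ n)⁻¹ * cs.simple j then 1 else 0) := by
  induction k with
  | zero => simp
  | succ k ih =>
    rw [Function.iterate_succ_apply', ih]
    set x := cs.simple i * cs.simple j with hx
    clear_value x
    have hj : cs.simple j * cs.simple j = 1 := cs.simple_mul_simple_self j
    have hi : cs.simple i * cs.simple i = 1 := cs.simple_mul_simple_self i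
    have hjx : cs.simple j * x = x⁻¹ * cs.simple j := by
      rw [hx, mul_inv_rev, cs.inv_simple, cs.inv_simple]; group
    have hjxn : ∀ n : ℕ, cs.simple j * x ^ n = (x ^ n)⁻¹ * cs.simple j := by
      intro n
      induction n with
      | zero => simp
      | succ n ihn => rw [pow_succ, ← mul_assoc, ihn, mul_assoc, hjx, ← mul_assoc, ← mul_inv_rev,
          ← pow_succ', pow_succ]
    have e1 : (x ^ k * p.1 * (x ^ k)⁻¹ = cs.simple j) ↔
        p.1 = (x ^ (2 * k))⁻¹ * cs.simple j := by
      have : x ^ (2 * k) = x ^ k * x ^ k := by rw [two_mul, pow_add]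
      rw [this, mul_inv_rev, mul_assoc _ _ (cs.simple j), ← hjxn, mul_inv_eq_iff_eq_mul,
        eq_inv_mul_iff_mul_eq]
    have e2 : (cs.simple j * (x ^ k * p.1 * (x ^ k)⁻¹) * cs.simple j = cs.simple i) ↔
        p.1 = (x ^ (2 * k + 1))⁻¹ * cs.simple j := by
      have : x ^ (2 * k + 1) = x ^ k * x * x ^ k := by
        rw [← pow_succ, ← pow_add]; congr 1; ring
      have h3 : (cs.simple j * (x ^ k * p.1 * (x ^ k)⁻¹) * cs.simple j = cs.simple i) ↔
          x ^ k * p.1 * (x ^ k)⁻¹ = cs.simple j * cs.simple i * cs.simple j := by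
        constructor
        · intro h; rw [← h]; simp [mul_assoc, hj]
        · intro h; rw [h]; simp [mul_assoc, hj]
      have h4 : cs.simple j * cs.simple i * cs.simple j = x⁻¹ * cs.simple j := by
        rw [← hjx, hx, mul_assoc]
      rw [h3, h4, mul_inv_eq_iff_eq_mul, mul_assoc x⁻¹, hjxn, this]
      constructor
      · intro h; rw [eq_comm, mul_inv_rev, mul_inv_rev, mul_assoc, mul_assoc, ← h]; group
      · intro h; rw [h]; group
    have : 2 * (k + 1) = 2 * k + 1 + 1 := by ring
    rw [this, Finset.sum_range_succ, Finset.sum_range_succ]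
    simp only [Function.comp, invPerm, e1, e2]
    refine Prod.ext ?_ ?_
    · simp only [pow_succ' x k, mul_inv_rev]
      rw [show x⁻¹ = cs.simple j * cs.simple i by
        rw [hx, mul_inv_rev, cs.inv_simple, cs.inv_simple]]
      simp only [mul_assoc]
      rw [← mul_assoc (cs.simple i) (cs.simple j), ← hx]
    · simp only [add_assoc]

theorem invPerm_liftable :
    M.IsLiftable (G := Function.End (W × ZMod 2)) (fun i => (invPerm cs i : W × ZMod 2 → W × ZMod 2)) := by
  classical
  intro i j
  have key : ((invPerm cs i ∘ invPerm cs j)^[M i j]) = id := by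
    funext p
    rw [invPerm_iterate, two_mul, Finset.sum_range_add, cs.simple_mul_simple_pow]
    simp only [pow_add, cs.simple_mul_simple_pow, one_mul, id]
    rw [← two_mul, show (2 : ZMod 2) = 0 from rfl]
    simp
  have h2 : ∀ (f : Function.End (W × ZMod 2)) (n : ℕ), f ^ n = (f : W × ZMod 2 → W × ZMod 2)^[n] := by
    intro f n
    induction n with
    | zero => rfl
    | succ n ih =>
      rw [pow_succ, ih]
      exact (Function.iterate_succ (f : W × ZMod 2 → W × ZMod 2) n).symm
  rw [h2]; exact key

/-- The action of `W` on `W × ZMod 2` extending `invPerm`. -/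
noncomputable def invHom : W →* Function.End (W × ZMod 2) :=
  cs.lift ⟨_, invPerm_liftable cs⟩

theorem invHom_simple (i : B) : invHom cs (cs.simple i) = invPerm cs i :=
  cs.lift_apply_simple (invPerm_liftable cs) i

theorem invHom_mul_apply (v w : W) (p : W × ZMod 2) :
    invHom cs (v * w) p = invHom cs v (invHom cs w p) := by
  rw [map_mul]; rfl

open scoped Classical in
theorem invHom_wordProd (ω : List B) (p : W × ZMod 2) :
    invHom cs (cs.wordProd ω) p =
      (cs.wordProd ω * p.1 * (cs.wordProd ω)⁻¹, p.2 + ((cs.rightInvSeq ω).count p.1 : ZMod 2)) := by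
  induction ω with
  | nil => simp [wordProd_nil, map_one, Function.End.one_def]
  | cons i ω ih =>
    rw [wordProd_cons, invHom_mul_apply, ih, invHom_simple]
    refine Prod.ext ?_ ?_
    · simp [invPerm, mul_assoc]
    · simp only [invPerm, rightInvSeq, List.count_cons, Nat.cast_add, Nat.cast_ite, Nat.cast_one,
        Nat.cast_zero, add_assoc]
      congr 2
      simp only [beq_iff_eq]
      congr 1
      rw [mul_inv_eq_iff_eq_mul, mul_assoc, inv_mul_eq_iff_eq_mul]
      exact propext eq_comm

/-- The parity of the number of occurrences of `x` in the right inversion sequence of a word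
for `w`. -/
noncomputable def invParity (w x : W) : ZMod 2 := (invHom cs w (x, 0)).2

open scoped Classical in
theorem invParity_wordProd (ω : List B) (x : W) :
    invParity cs (cs.wordProd ω) x = ((cs.rightInvSeq ω).count x : ZMod 2) := by
  simp [invParity, invHom_wordProd]

theorem invParity_mul_simple (w : W) (j : B) (x : W) [Decidable (x = cs.simple j)] :
    invParity cs (w * cs.simple j) x =
      invParity cs w (cs.simple j * x * cs.simple j) + if x = cs.simple j then 1 else 0 := by
  classical
  obtain ⟨ω, rfl⟩ := cs.wordProd_surjective w
  unfold invParity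
  rw [invHom_mul_apply, invHom_simple, invHom_wordProd, invHom_wordProd]
  simp only [invPerm, zero_add]
  rw [add_comm]
  congr

theorem mem_rightInvSeq_iff {ω : List B} (hω : cs.IsReduced ω) (x : W) :
    x ∈ cs.rightInvSeq ω ↔ invParity cs (cs.wordProd ω) x = 1 := by
  classical
  rw [invParity_wordProd]
  by_cases hx : x ∈ cs.rightInvSeq ω
  · rw [List.count_eq_one_of_mem (hω.nodup_rightInvSeq) hx]; simp [hx]
  · rw [List.count_eq_zero_of_not_mem hx]; simp [hx]

theorem isRightDescent_iff_invParity (w : W) (i : B) :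
    cs.IsRightDescent w i ↔ invParity cs w (cs.simple i) = 1 := by
  classical
  have key : ∀ v : W, invParity cs v (cs.simple i) = 1 → cs.IsRightDescent v i := by
    intro v hv
    obtain ⟨ω, hω, rfl⟩ := cs.exists_isReduced v
    exact (cs.isRightInversion_of_mem_rightInvSeq hω ((mem_rightInvSeq_iff cs hω _).2 hv)).2
  refine ⟨fun h => ?_, key w⟩
  by_contra hne
  have h0 : ∀ a : ZMod 2, a ≠ 1 → a = 0 := by decide
  have h1 : invParity cs (w * cs.simple i) (cs.simple i) = 1 := by
    rw [invParity_mul_simple]; simp [h0 _ hne]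
  have h2 := key _ h1
  rw [IsRightDescent, mul_assoc, simple_mul_simple_self, mul_one] at h2
  exact absurd h (not_lt.2 h2.le)

theorem isRightDescent_simple_mul_iff {w : W} {i j : B}
    (h : cs.simple i * w ≠ w * cs.simple j) :
    cs.IsRightDescent (cs.simple i * w) j ↔ cs.IsRightDescent w j := by
  classical
  rw [isRightDescent_iff_invParity, isRightDescent_iff_invParity]
  obtain ⟨ω, rfl⟩ := cs.wordProd_surjective w
  rw [← wordProd_cons, invParity_wordProd, invParity_wordProd, rightInvSeq, List.count_cons_of_ne]
  intro h'
  apply h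
  rw [mul_assoc, inv_mul_eq_iff_eq_mul] at h'
  exact h'

theorem isLeftDescent_mul_simple_iff {w : W} {i j : B}
    (h : cs.simple i * w ≠ w * cs.simple j) :
    cs.IsLeftDescent (w * cs.simple j) i ↔ cs.IsLeftDescent w i := by
  have h' : cs.simple j * w⁻¹ ≠ w⁻¹ * cs.simple i := by
    intro h2; apply h
    have := congrArg (·⁻¹) h2
    simpa using this.symm
  have := isRightDescent_simple_mul_iff cs h'
  rw [isRightDescent_inv_iff] at this
  rw [← this, ← isRightDescent_inv_iff]
  simp

end Coxeter


section Weights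

variable {B W : Type*} [Group W] {M : CoxeterMatrix B}

/-- A system of parameters `c_s`: positive integers, equal for conjugate simple reflections. -/
structure HeckeParam (cs : CoxeterSystem M W) where
  c : B → ℕ
  pos : ∀ i, 0 < c i
  conj : ∀ i j, IsConj (cs.simple i) (cs.simple j) → c i = c j

variable {cs : CoxeterSystem M W} (p : HeckeParam cs)

open scoped Classical in
theorem HeckeParam.exists_sum_rightInvSeq (p : HeckeParam cs) :
    ∃ f : W → ℕ, ∀ ω : List B, ((cs.rightInvSeq ω).map f).sum = (ω.map p.c).sum := by
  refine ⟨fun x => if h : ∃ i, IsConj (cs.simple i) x then p.c h.choose else 0, fun ω => ?_⟩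
  induction ω with
  | nil => simp
  | cons i ω ih =>
    rw [CoxeterSystem.rightInvSeq, List.map_cons, List.map_cons, List.sum_cons, List.sum_cons, ih]
    congr 1
    have hc : IsConj (cs.simple i) ((cs.wordProd ω)⁻¹ * cs.simple i * cs.wordProd ω) :=
      isConj_iff.2 ⟨(cs.wordProd ω)⁻¹, by simp⟩
    have h : ∃ j, IsConj (cs.simple j) ((cs.wordProd ω)⁻¹ * cs.simple i * cs.wordProd ω) := ⟨i, hc⟩
    rw [dif_pos h]
    exact p.conj _ _ (h.choose_spec.trans hc.symm)

/-- The weight `c_{s_1} + ⋯ + c_{s_k}` of a reduced word `s_1 ⋯ s_k` of `w`. -/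
noncomputable def HeckeParam.weight (w : W) : ℕ :=
  ((cs.exists_isReduced w).choose.map p.c).sum

theorem HeckeParam.weight_eq {ω : List B} (hω : cs.IsReduced ω) :
    p.weight (cs.wordProd ω) = (ω.map p.c).sum := by
  obtain ⟨f, hf⟩ := p.exists_sum_rightInvSeq
  have hs := (cs.exists_isReduced (cs.wordProd ω)).choose_spec
  rw [HeckeParam.weight, ← hf, ← hf]
  refine List.Perm.sum_eq (List.Perm.map _ ?_)
  rw [List.perm_ext_iff_of_nodup hs.1.nodup_rightInvSeq hω.nodup_rightInvSeq]
  intro x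
  rw [mem_rightInvSeq_iff cs hs.1, mem_rightInvSeq_iff cs hω, ← hs.2]

theorem HeckeParam.weight_one : p.weight 1 = 0 := by
  have := p.weight_eq (ω := []) (by simp [CoxeterSystem.IsReduced])
  simpa using this

theorem HeckeParam.weight_simple_mul {w : W} {i : B} (h : ¬ cs.IsLeftDescent w i) :
    p.weight (cs.simple i * w) = p.c i + p.weight w := by
  obtain ⟨ω, hω, rfl⟩ := cs.exists_isReduced w
  rw [← CoxeterSystem.wordProd_cons, p.weight_eq hω, p.weight_eq]
  · simp
  · rw [CoxeterSystem.IsReduced, CoxeterSystem.wordProd_cons, (cs.not_isLeftDescent_iff).1 h, hω]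
    simp

end Weights

section HeckeAlgebra

variable {B W : Type*} [Group W] {M : CoxeterMatrix B} {cs : CoxeterSystem M W}
  (p : HeckeParam cs)

/-- The ring `ℤ[t, t⁻¹]`; `LaurentPolynomial.T n` is `t ^ n`. -/
abbrev ZT : Type := LaurentPolynomial ℤ

/-- The parameter `q ^ c_s = t ^ (2 c_s)`. -/
noncomputable def HeckeParam.q (i : B) : ZT := LaurentPolynomial.T (2 * (p.c i : ℤ))

/-- The defining relations of the generic Hecke algebra on generators `T_w`, `w ∈ W`:
`T_1 = 1`, `T_s T_w = T_{sw}` if `sw > w`, and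
`T_s T_w = t^{2c_s} T_{sw} + (t^{2c_s} - 1) T_w` if `sw < w`. -/
inductive HeckeRel : FreeAlgebra ZT W → FreeAlgebra ZT W → Prop
  | one : HeckeRel (FreeAlgebra.ι ZT 1) 1
  | up (i : B) (w : W) (h : cs.length w < cs.length (cs.simple i * w)) :
      HeckeRel (FreeAlgebra.ι ZT (cs.simple i) * FreeAlgebra.ι ZT w)
        (FreeAlgebra.ι ZT (cs.simple i * w))
  | down (i : B) (w : W) (h : cs.length (cs.simple i * w) < cs.length w) :
      HeckeRel (FreeAlgebra.ι ZT (cs.simple i) * FreeAlgebra.ι ZT w)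
        (p.q i • FreeAlgebra.ι ZT (cs.simple i * w) + (p.q i - 1) • FreeAlgebra.ι ZT w)

/-- The generic Hecke algebra over `ℤ[t, t⁻¹]`. -/
def Hecke : Type _ := RingQuot (HeckeRel p)

noncomputable instance : Ring (Hecke p) := inferInstanceAs (Ring (RingQuot (HeckeRel p)))
noncomputable instance : Algebra ZT (Hecke p) :=
  inferInstanceAs (Algebra ZT (RingQuot (HeckeRel p)))

/-- The standard generator `T_w`. -/
noncomputable def heckeT (w : W) : Hecke p :=
  RingQuot.mkAlgHom ZT (HeckeRel p) (FreeAlgebra.ι ZT w)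

theorem heckeT_one : heckeT p 1 = 1 :=
  (RingQuot.mkAlgHom_rel ZT (HeckeRel.one (p := p))).trans (map_one _)

theorem heckeT_simple_mul_up {i : B} {w : W} (h : ¬ cs.IsLeftDescent w i) :
    heckeT p (cs.simple i) * heckeT p w = heckeT p (cs.simple i * w) := by
  have := RingQuot.mkAlgHom_rel ZT (HeckeRel.up (p := p) i w (by
    have := (cs.not_isLeftDescent_iff).1 h; omega))
  rwa [map_mul] at this

theorem heckeT_simple_mul_down {i : B} {w : W} (h : cs.IsLeftDescent w i) :
    heckeT p (cs.simple i) * heckeT p w =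
      p.q i • heckeT p (cs.simple i * w) + (p.q i - 1) • heckeT p w := by
  have := RingQuot.mkAlgHom_rel ZT (HeckeRel.down (p := p) i w h)
  rwa [map_mul, map_add, map_smul, map_smul] at this

open scoped Classical in
/-- Left multiplication by `T_s` on the free module with basis `W`. -/
noncomputable def leftOp (i : B) : Module.End ZT (W →₀ ZT) :=
  Finsupp.linearCombination ZT fun w =>
    if cs.IsLeftDescent w i then
      p.q i • Finsupp.single (cs.simple i * w) 1 + (p.q i - 1) • Finsupp.single w 1
    else Finsupp.single (cs.simple i * w) 1

open scoped Classical in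
/-- Right multiplication by `T_s` on the free module with basis `W`. -/
noncomputable def rightOp (i : B) : Module.End ZT (W →₀ ZT) :=
  Finsupp.linearCombination ZT fun w =>
    if cs.IsRightDescent w i then
      p.q i • Finsupp.single (w * cs.simple i) 1 + (p.q i - 1) • Finsupp.single w 1
    else Finsupp.single (w * cs.simple i) 1

open scoped Classical in
theorem leftOp_single (i : B) (w : W) : leftOp p i (Finsupp.single w 1) =
    if cs.IsLeftDescent w i then
      p.q i • Finsupp.single (cs.simple i * w) 1 + (p.q i - 1) • Finsupp.single w 1
    else Finsupp.single (cs.simple i * w) 1 := by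
  rw [leftOp, Finsupp.linearCombination_single, one_smul]

open scoped Classical in
theorem rightOp_single (i : B) (w : W) : rightOp p i (Finsupp.single w 1) =
    if cs.IsRightDescent w i then
      p.q i • Finsupp.single (w * cs.simple i) 1 + (p.q i - 1) • Finsupp.single w 1
    else Finsupp.single (w * cs.simple i) 1 := by
  rw [rightOp, Finsupp.linearCombination_single, one_smul]

theorem leftOp_rightOp (i j : B) : leftOp p i * rightOp p j = rightOp p j * leftOp p i := by
  classical
  refine Finsupp.lhom_ext' fun w => LinearMap.ext_ring ?_
  simp only [LinearMap.comp_apply, Module.End.mul_apply, Finsupp.lsingle_apply]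
  by_cases hw : cs.simple i * w = w * cs.simple j
  · have hq : p.q i = p.q j := by
      rw [HeckeParam.q, HeckeParam.q, p.conj i j]
      exact isConj_iff.2 ⟨w⁻¹, by rw [mul_assoc, inv_inv, hw]; simp⟩
    have hswt : cs.simple i * (w * cs.simple j) = w := by
      rw [← hw, cs.simple_mul_simple_cancel_left]
    have hLR : cs.IsRightDescent w j ↔ cs.IsLeftDescent w i := by
      rw [CoxeterSystem.IsRightDescent, CoxeterSystem.IsLeftDescent, hw]
    have hL : cs.IsLeftDescent (w * cs.simple j) i ↔ ¬ cs.IsLeftDescent w i := by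
      rw [← hw, cs.isLeftDescent_iff_not_isLeftDescent_mul, cs.simple_mul_simple_cancel_left]
    have hR : cs.IsRightDescent (w * cs.simple j) j ↔ ¬ cs.IsLeftDescent w i := by
      rw [cs.isRightDescent_iff_not_isRightDescent_mul, cs.simple_mul_simple_cancel_right, hLR]
    by_cases h : cs.IsLeftDescent w i
    · simp only [leftOp_single, rightOp_single, hLR, h, if_true, map_add, map_smul, hw, hL, hR,
        not_true, if_false, hswt, cs.simple_mul_simple_cancel_right, hq]
    · simp only [leftOp_single, rightOp_single, hLR, h, if_true, hw, hL, hR,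
        not_false_eq_true, if_false, hswt, cs.simple_mul_simple_cancel_right, hq]
  · have h1 := isRightDescent_simple_mul_iff cs hw
    have h2 := isLeftDescent_mul_simple_iff cs hw
    by_cases hi : cs.IsLeftDescent w i <;> by_cases hj : cs.IsRightDescent w j <;>
      simp only [leftOp_single, rightOp_single, h1, h2, hi, hj, if_true, if_false, map_add,
        map_smul, mul_assoc]
    all_goals module

/-- The operators commuting with all right multiplications. -/
noncomputable def rightCentralizer : Subalgebra ZT (Module.End ZT (W →₀ ZT)) :=
  Subalgebra.centralizer ZT (Set.range (rightOp p))

theorem leftOp_mem (i : B) : leftOp p i ∈ rightCentralizer p := by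
  rw [rightCentralizer, Subalgebra.mem_centralizer_iff]
  rintro _ ⟨j, rfl⟩
  exact (leftOp_rightOp p i j).symm

theorem rightCentralizer_ext {X Y : Module.End ZT (W →₀ ZT)} (hX : X ∈ rightCentralizer p)
    (hY : Y ∈ rightCentralizer p)
    (h : X (Finsupp.single 1 1) = Y (Finsupp.single 1 1)) : X = Y := by
  classical
  rw [rightCentralizer, Subalgebra.mem_centralizer_iff] at hX hY
  refine Finsupp.lhom_ext' fun w => LinearMap.ext_ring ?_
  simp only [LinearMap.comp_apply, Finsupp.lsingle_apply]
  induction hn : cs.length w generalizing w with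
  | zero => rw [cs.length_eq_zero_iff] at hn; rw [hn, h]
  | succ n ih =>
    obtain ⟨j, hj⟩ := cs.exists_rightDescent_of_ne_one (w := w) (by
      rintro rfl; simp at hn)
    have hl := (cs.isRightDescent_iff).1 hj
    have hnd := (cs.isRightDescent_iff_not_isRightDescent_mul).1 hj
    have hw : (Finsupp.single w 1 : W →₀ ZT) =
        rightOp p j (Finsupp.single (w * cs.simple j) 1) := by
      rw [rightOp_single, if_neg hnd, cs.simple_mul_simple_cancel_right]
    have hX' := LinearMap.congr_fun (hX _ ⟨j, rfl⟩) (Finsupp.single (w * cs.simple j) 1)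
    have hY' := LinearMap.congr_fun (hY _ ⟨j, rfl⟩) (Finsupp.single (w * cs.simple j) 1)
    rw [Module.End.mul_apply, Module.End.mul_apply] at hX' hY'
    rw [hw, ← hX', ← hY', ih _ (by omega)]

theorem exists_leftOp (w : W) : ∃ X ∈ rightCentralizer p,
    X (Finsupp.single 1 1) = Finsupp.single w 1 := by
  classical
  induction hn : cs.length w generalizing w with
  | zero => rw [cs.length_eq_zero_iff] at hn; exact ⟨1, one_mem _, by rw [hn]; rfl⟩
  | succ n ih =>
    obtain ⟨i, hi⟩ := cs.exists_leftDescent_of_ne_one (w := w) (by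
      rintro rfl; simp at hn)
    have hl := (cs.isLeftDescent_iff).1 hi
    have hnd := (cs.isLeftDescent_iff_not_isLeftDescent_mul).1 hi
    obtain ⟨X, hX, hX1⟩ := ih (cs.simple i * w) (by omega)
    refine ⟨leftOp p i * X, mul_mem (leftOp_mem p i) hX, ?_⟩
    rw [Module.End.mul_apply, hX1, leftOp_single, if_neg hnd, cs.simple_mul_simple_cancel_left]

/-- The regular representation of the Hecke algebra on the free module with basis `W`. -/
theorem exists_regularRep : ∃ F : Hecke p →ₐ[ZT] Module.End ZT (W →₀ ZT),
    ∀ w, F (heckeT p w) (Finsupp.single 1 1) = Finsupp.single w 1 := by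
  classical
  choose X hX hX1 using exists_leftOp p
  have hs : ∀ i, X (cs.simple i) = leftOp p i := fun i => by
    refine rightCentralizer_ext p (hX _) (leftOp_mem p i) ?_
    rw [hX1, leftOp_single, if_neg (cs.not_isLeftDescent_one i), mul_one]
  have hrel : ∀ ⦃x y⦄, HeckeRel p x y → FreeAlgebra.lift ZT X x = FreeAlgebra.lift ZT X y := by
    intro x y h
    induction h with
    | one =>
      rw [FreeAlgebra.lift_ι_apply, map_one]
      exact rightCentralizer_ext p (hX _) (one_mem _) (hX1 1)
    | up i w h =>
      rw [map_mul, FreeAlgebra.lift_ι_apply, FreeAlgebra.lift_ι_apply, FreeAlgebra.lift_ι_apply]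
      refine rightCentralizer_ext p (mul_mem (hX _) (hX _)) (hX _) ?_
      rw [Module.End.mul_apply, hX1, hX1, hs, leftOp_single, if_neg (show ¬ cs.IsLeftDescent w i from not_lt.2 h.le)]
    | down i w h =>
      simp only [map_mul, map_add, map_smul, FreeAlgebra.lift_ι_apply]
      refine rightCentralizer_ext p (mul_mem (hX _) (hX _))
        (add_mem (Subalgebra.smul_mem _ (hX _) _) (Subalgebra.smul_mem _ (hX _) _)) ?_
      rw [Module.End.mul_apply, hX1, LinearMap.add_apply, LinearMap.smul_apply,
        LinearMap.smul_apply, hX1, hX1, hs, leftOp_single,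
        if_pos (show cs.IsLeftDescent w i from h)]
  refine ⟨RingQuot.liftAlgHom ZT ⟨FreeAlgebra.lift ZT X, hrel⟩, fun w => ?_⟩
  have : RingQuot.liftAlgHom ZT ⟨FreeAlgebra.lift ZT X, hrel⟩ (heckeT p w) = X w := by
    rw [heckeT]
    exact (RingQuot.liftAlgHom_mkAlgHom_apply (S := ZT) _ hrel _).trans
      (FreeAlgebra.lift_ι_apply _ _)
  exact (LinearMap.congr_fun this _).trans (hX1 w)

theorem heckeT_linearIndependent : LinearIndependent ZT (heckeT p) := by
  obtain ⟨F, hF⟩ := exists_regularRep p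
  let e : Hecke p →ₗ[ZT] (W →₀ ZT) :=
    (LinearMap.applyₗ (Finsupp.single 1 1 : W →₀ ZT)).comp F.toLinearMap
  refine LinearIndependent.of_comp e ?_
  have : (e ∘ heckeT p : W → (W →₀ ZT)) = fun w => Finsupp.single w 1 := funext hF
  rw [this]
  exact Finsupp.linearIndependent_single_one ZT W

theorem heckeT_mul_mem_span (v w : W) :
    heckeT p v * heckeT p w ∈ Submodule.span ZT (Set.range (heckeT p)) := by
  have hm : ∀ x, heckeT p x ∈ Submodule.span ZT (Set.range (heckeT p)) :=
    fun x => Submodule.subset_span ⟨x, rfl⟩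
  have hs : ∀ i, ∀ x ∈ Submodule.span ZT (Set.range (heckeT p)),
      heckeT p (cs.simple i) * x ∈ Submodule.span ZT (Set.range (heckeT p)) := by
    intro i x hx
    induction hx using Submodule.span_induction with
    | mem x hx =>
      obtain ⟨u, rfl⟩ := hx
      by_cases h : cs.IsLeftDescent u i
      · rw [heckeT_simple_mul_down p h]
        exact add_mem (Submodule.smul_mem _ _ (hm _)) (Submodule.smul_mem _ _ (hm _))
      · rw [heckeT_simple_mul_up p h]; exact hm _
    | zero => rw [mul_zero]; exact zero_mem _
    | add x y _ _ hx hy => rw [mul_add]; exact add_mem hx hy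
    | smul a x _ hx => rw [mul_smul_comm]; exact Submodule.smul_mem _ _ hx
  induction hn : cs.length v generalizing v with
  | zero => rw [cs.length_eq_zero_iff] at hn; rw [hn, heckeT_one, one_mul]; exact hm w
  | succ n ih =>
    obtain ⟨i, hi⟩ := cs.exists_leftDescent_of_ne_one (w := v) (by rintro rfl; simp at hn)
    have hl := (cs.isLeftDescent_iff).1 hi
    have hnd := (cs.isLeftDescent_iff_not_isLeftDescent_mul).1 hi
    have : heckeT p v = heckeT p (cs.simple i) * heckeT p (cs.simple i * v) := by
      rw [heckeT_simple_mul_up p hnd, cs.simple_mul_simple_cancel_left]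
    rw [this, mul_assoc]
    exact hs i _ (ih _ (by omega))

theorem heckeT_span : ⊤ ≤ Submodule.span ZT (Set.range (heckeT p)) := by
  rintro x -
  obtain ⟨y, rfl⟩ := RingQuot.mkAlgHom_surjective ZT (HeckeRel p) x
  induction y using FreeAlgebra.induction with
  | grade0 r =>
    rw [AlgHom.commutes, Algebra.algebraMap_eq_smul_one]
    refine Submodule.smul_mem _ _ ?_
    have := heckeT_one p
    exact this ▸ Submodule.subset_span ⟨1, rfl⟩
  | grade1 w => exact Submodule.subset_span ⟨w, rfl⟩
  | mul a b ha hb =>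
    rw [map_mul]
    have h : Submodule.span ZT (Set.range (heckeT p)) * Submodule.span ZT (Set.range (heckeT p)) ≤
        Submodule.span ZT (Set.range (heckeT p)) := by
      rw [Submodule.span_mul_span, Submodule.span_le]
      rintro _ ⟨_, ⟨v, rfl⟩, _, ⟨w, rfl⟩, rfl⟩
      exact heckeT_mul_mem_span p v w
    exact h (Submodule.mul_mem_mul ha hb)
  | add a b ha hb => rw [map_add]; exact add_mem ha hb

/-- The basis `(T_w)` of the generic Hecke algebra. -/
noncomputable def heckeBasis : Module.Basis W ZT (Hecke p) :=
  Module.Basis.mk (heckeT_linearIndependent p) (heckeT_span p)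

@[simp] theorem heckeBasis_apply (w : W) : heckeBasis p w = heckeT p w :=
  Module.Basis.mk_apply _ _ _

end HeckeAlgebra

section KL

variable {B W : Type*} [Group W] {M : CoxeterMatrix B} {cs : CoxeterSystem M W}
  (p : HeckeParam cs)

/-- The monomial `t ^ n`. -/
noncomputable abbrev tp (n : ℤ) : ZT := LaurentPolynomial.T n

theorem heckeT_simple_mul_inv (i : B) :
    heckeT p (cs.simple i) * (tp (-(2 * (p.c i : ℤ))) • heckeT p (cs.simple i)
      + (tp (-(2 * (p.c i : ℤ))) - 1 : ZT) • 1) = 1 := by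
  have h := heckeT_simple_mul_down p (i := i) (w := cs.simple i)
    (by rw [CoxeterSystem.IsLeftDescent, cs.simple_mul_simple_self]; simp)
  rw [cs.simple_mul_simple_self, heckeT_one] at h
  rw [mul_add, mul_smul_comm, mul_smul_comm, mul_one, h, smul_add, smul_smul, smul_smul, mul_sub,
    HeckeParam.q, ← LaurentPolynomial.T_add]
  simp only [neg_add_cancel, LaurentPolynomial.T_zero]
  module

theorem heckeT_simple_inv_mul (i : B) :
    (tp (-(2 * (p.c i : ℤ))) • heckeT p (cs.simple i)
      + (tp (-(2 * (p.c i : ℤ))) - 1 : ZT) • 1) * heckeT p (cs.simple i) = 1 := by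
  have h := heckeT_simple_mul_inv p i
  rw [mul_add, mul_smul_comm, mul_smul_comm, mul_one] at h
  rw [add_mul, smul_mul_assoc, smul_mul_assoc, one_mul, h]

theorem isUnit_heckeT (w : W) : IsUnit (heckeT p w) := by
  induction hn : cs.length w generalizing w with
  | zero => rw [cs.length_eq_zero_iff] at hn; rw [hn, heckeT_one]; exact isUnit_one
  | succ n ih =>
    obtain ⟨i, hi⟩ := cs.exists_leftDescent_of_ne_one (w := w) (by rintro rfl; simp at hn)
    have hl := (cs.isLeftDescent_iff).1 hi
    have hnd := (cs.isLeftDescent_iff_not_isLeftDescent_mul).1 hi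
    have : heckeT p w = heckeT p (cs.simple i) * heckeT p (cs.simple i * w) := by
      rw [heckeT_simple_mul_up p hnd, cs.simple_mul_simple_cancel_left]
    rw [this]
    exact IsUnit.mul ⟨⟨_, _, heckeT_simple_mul_inv p i, heckeT_simple_inv_mul p i⟩, rfl⟩
      (ih _ (by omega))

/-- The bar involution `∑ a_w T_w ↦ ∑ ā_w (T_{w⁻¹})⁻¹`, where `t ↦ t⁻¹` on coefficients. -/
noncomputable def heckeBar (x : Hecke p) : Hecke p :=
  ((heckeBasis p).repr x).sum fun w a =>
    LaurentPolynomial.invert a • (((isUnit_heckeT p w⁻¹).unit⁻¹ : (Hecke p)ˣ) : Hecke p)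

theorem heckeBar_add (x y : Hecke p) : heckeBar p (x + y) = heckeBar p x + heckeBar p y := by
  rw [heckeBar, map_add]
  exact Finsupp.sum_add_index' (by simp) (by intros; rw [map_add, add_smul])

theorem heckeBar_smul (a : ZT) (x : Hecke p) :
    heckeBar p (a • x) = LaurentPolynomial.invert a • heckeBar p x := by
  rw [heckeBar, map_smul, Finsupp.sum_smul_index (by simp), heckeBar, Finsupp.smul_sum]
  simp only [map_mul, mul_smul]

theorem heckeBar_zero : heckeBar p 0 = 0 := by simp [heckeBar]

theorem heckeBar_sub (x y : Hecke p) : heckeBar p (x - y) = heckeBar p x - heckeBar p y := by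
  have h : x - y = x + (-1 : ZT) • y := by rw [neg_one_smul, sub_eq_add_neg]
  rw [h, heckeBar_add, heckeBar_smul, map_neg, map_one, neg_one_smul, sub_eq_add_neg]

theorem heckeBar_sum {ι : Type*} (s : Finset ι) (f : ι → Hecke p) :
    heckeBar p (∑ i ∈ s, f i) = ∑ i ∈ s, heckeBar p (f i) :=
  map_sum (AddMonoidHom.mk' (heckeBar p) (heckeBar_add p)) f s

theorem heckeBar_T (w : W) : heckeBar p (heckeT p w) =
    (((isUnit_heckeT p w⁻¹).unit⁻¹ : (Hecke p)ˣ) : Hecke p) := by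
  rw [heckeBar, ← heckeBasis_apply, Module.Basis.repr_self, Finsupp.sum_single_index (by simp)]
  simp

theorem heckeT_mul_simple_up {i : B} {w : W} (h : cs.length w < cs.length (w * cs.simple i)) :
    heckeT p w * heckeT p (cs.simple i) = heckeT p (w * cs.simple i) := by
  induction hn : cs.length w generalizing w with
  | zero => rw [cs.length_eq_zero_iff] at hn; rw [hn, heckeT_one, one_mul, one_mul]
  | succ n ih =>
    obtain ⟨j, hj⟩ := cs.exists_leftDescent_of_ne_one (w := w) (by rintro rfl; simp at hn)
    have hl := (cs.isLeftDescent_iff).1 hj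
    have hnd := (cs.isLeftDescent_iff_not_isLeftDescent_mul).1 hj
    have e : heckeT p w = heckeT p (cs.simple j) * heckeT p (cs.simple j * w) := by
      rw [heckeT_simple_mul_up p hnd, cs.simple_mul_simple_cancel_left]
    have h2 := cs.length_simple_mul (w * cs.simple i) j
    have h3 := cs.length_mul_simple (cs.simple j * w) i
    have h4 := cs.length_mul_simple w i
    rw [mul_assoc] at h3
    rw [e, mul_assoc, ih (w := cs.simple j * w) (by rw [mul_assoc]; omega) (by omega),
      heckeT_simple_mul_up p, mul_assoc, cs.simple_mul_simple_cancel_left]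
    rw [CoxeterSystem.IsLeftDescent, mul_assoc, cs.simple_mul_simple_cancel_left]
    omega

theorem heckeBar_T_simple_mul {i : B} {w : W} (h : ¬ cs.IsLeftDescent w i) :
    heckeBar p (heckeT p (cs.simple i * w)) =
      heckeBar p (heckeT p (cs.simple i)) * heckeBar p (heckeT p w) := by
  rw [heckeBar_T, heckeBar_T, heckeBar_T, ← Units.val_mul, ← mul_inv_rev]
  congr 2
  ext
  rw [Units.val_mul, IsUnit.unit_spec, IsUnit.unit_spec, IsUnit.unit_spec, cs.inv_simple,
    heckeT_mul_simple_up, mul_inv_rev, cs.inv_simple]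
  have := (cs.not_isLeftDescent_iff).1 h
  rw [← cs.length_inv w, ← cs.length_inv (cs.simple i * w), mul_inv_rev, cs.inv_simple] at this
  omega

theorem heckeBar_T_simple (i : B) : heckeBar p (heckeT p (cs.simple i)) =
    tp (-(2 * (p.c i : ℤ))) • heckeT p (cs.simple i)
      + (tp (-(2 * (p.c i : ℤ))) - 1 : ZT) • 1 := by
  rw [heckeBar_T]
  refine Units.inv_eq_of_mul_eq_one_right ?_
  rw [IsUnit.unit_spec, cs.inv_simple, heckeT_simple_mul_inv]

theorem hecke_induction {P : Hecke p → Prop} (hT : ∀ w, P (heckeT p w))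
    (hadd : ∀ x y, P x → P y → P (x + y)) (hsmul : ∀ (a : ZT) x, P x → P (a • x))
    (x : Hecke p) : P x := by
  have hx := heckeT_span p (Submodule.mem_top (x := x))
  induction hx using Submodule.span_induction with
  | mem x hx => obtain ⟨w, rfl⟩ := hx; exact hT w
  | zero => have := hsmul 0 _ (hT 1); rwa [zero_smul] at this
  | add x y _ _ hx hy => exact hadd x y hx hy
  | smul a x _ hx => exact hsmul a x hx

theorem heckeBar_simple_mul (i : B) (x : Hecke p) :
    heckeBar p (heckeT p (cs.simple i) * x) =
      heckeBar p (heckeT p (cs.simple i)) * heckeBar p x := by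
  induction x using hecke_induction with
  | hadd x y hx hy => rw [mul_add, heckeBar_add, hx, hy, heckeBar_add, mul_add]
  | hsmul a x hx => rw [mul_smul_comm, heckeBar_smul, hx, heckeBar_smul, mul_smul_comm]
  | hT w =>
    by_cases h : cs.IsLeftDescent w i
    · have hnd := (cs.isLeftDescent_iff_not_isLeftDescent_mul).1 h
      have e := heckeBar_T_simple_mul p hnd
      rw [cs.simple_mul_simple_cancel_left] at e
      rw [heckeT_simple_mul_down p h, heckeBar_add, heckeBar_smul, heckeBar_smul, e]
      have e2 : heckeBar p (heckeT p (cs.simple i)) * heckeBar p (heckeT p (cs.simple i)) =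
          tp (-(2 * (p.c i : ℤ))) • (1 : Hecke p) +
            (tp (-(2 * (p.c i : ℤ))) - 1 : ZT) • heckeBar p (heckeT p (cs.simple i)) := by
        have h3 := heckeT_simple_inv_mul p i
        rw [← heckeBar_T_simple] at h3
        nth_rewrite 2 [heckeBar_T_simple]
        rw [mul_add, mul_smul_comm, mul_smul_comm, h3, mul_one]
      rw [← mul_assoc, e2, add_mul, smul_mul_assoc, smul_mul_assoc, one_mul, map_sub, map_one,
        HeckeParam.q, LaurentPolynomial.invert_T]
    · rw [heckeT_simple_mul_up p h, heckeBar_T_simple_mul p h]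

/-- The element `t^{-c_s} (T_s + 1)`. -/
noncomputable def heckeCs (i : B) : Hecke p :=
  tp (-(p.c i : ℤ)) • (heckeT p (cs.simple i) + 1)

theorem heckeBar_Cs_mul (i : B) (x : Hecke p) :
    heckeBar p (heckeCs p i * x) = heckeCs p i * heckeBar p x := by
  rw [heckeCs, smul_mul_assoc, heckeBar_smul, add_mul, one_mul, heckeBar_add,
    heckeBar_simple_mul, heckeBar_T_simple, LaurentPolynomial.invert_T, smul_mul_assoc, add_mul,
    add_mul, one_mul, smul_mul_assoc, smul_mul_assoc, one_mul, add_assoc]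
  have : (tp (-(2 * (p.c i : ℤ))) - 1 : ZT) • heckeBar p x + heckeBar p x =
      tp (-(2 * (p.c i : ℤ))) • heckeBar p x := by module
  rw [this, ← smul_add, smul_smul, ← LaurentPolynomial.T_add]
  congr 2
  ring

/-- The coefficient of `x` at the normalized basis element `t^{-L(w)} T_w`, where `L` is the
weight function. -/
noncomputable def klCoeff (w : W) : Hecke p →ₗ[ZT] ZT :=
  tp (p.weight w) • (heckeBasis p).coord w

/-- `a ∈ t⁻¹ ℤ[t⁻¹]`. -/
def IsNegPart (a : ZT) : Prop := ∀ n : ℤ, 0 ≤ n → a.coeff n = 0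

/-- The characterization of the Kazhdan–Lusztig basis element `C'_w`: it is invariant under the
bar involution and congruent to `t^{-L(w)} T_w` modulo `∑_y t⁻¹ ℤ[t⁻¹] t^{-L(y)} T_y`. -/
def IsKL (w : W) (x : Hecke p) : Prop :=
  heckeBar p x = x ∧ klCoeff p w x = 1 ∧ ∀ y, y ≠ w → IsNegPart (klCoeff p y x)

theorem IsNegPart.zero : IsNegPart 0 := fun n _ => by simp

theorem exists_symm (a : ZT) :
    ∃ m : ZT, LaurentPolynomial.invert m = m ∧ IsNegPart (a - m) := by
  induction a using LaurentPolynomial.induction_on' with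
  | add f g hf hg =>
    obtain ⟨m, hm, hm'⟩ := hf
    obtain ⟨k, hk, hk'⟩ := hg
    refine ⟨m + k, by rw [map_add, hm, hk], fun n hn => ?_⟩
    have h1 := hm' n hn
    have h2 := hk' n hn
    rw [show f + g - (m + k) = (f - m) + (g - k) by ring, AddMonoidAlgebra.coeff_add,
      Finsupp.add_apply, h1, h2, add_zero]
  | C_mul_T n a =>
    rcases lt_trichotomy n 0 with h | h | h
    · refine ⟨0, map_zero _, fun k hk => ?_⟩
      rw [sub_zero, ← LaurentPolynomial.single_eq_C_mul_T, AddMonoidAlgebra.coeff_single,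
        Finsupp.single_apply, if_neg (by omega)]
    · subst h
      exact ⟨LaurentPolynomial.C a * LaurentPolynomial.T 0, by rw [map_mul]; simp,
        by rw [sub_self]; exact IsNegPart.zero⟩
    · refine ⟨LaurentPolynomial.C a * LaurentPolynomial.T n
        + LaurentPolynomial.C a * LaurentPolynomial.T (-n), ?_, fun k hk => ?_⟩
      · rw [map_add, map_mul, map_mul]; simp [add_comm]
      · rw [sub_add_cancel_left, ← LaurentPolynomial.single_eq_C_mul_T,
          ← AddMonoidAlgebra.single_neg, AddMonoidAlgebra.coeff_single,
          Finsupp.single_apply, if_neg (by omega)]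

theorem klCoeff_T (y w : W) [Decidable (w = y)] :
    klCoeff p y (heckeT p w) = if w = y then tp (p.weight w) else 0 := by
  classical
  rw [klCoeff, LinearMap.smul_apply, ← heckeBasis_apply, Module.Basis.coord_apply,
    Module.Basis.repr_self, Finsupp.single_apply]
  split_ifs with h
  · rw [h, smul_eq_mul, mul_one]
  · rw [smul_zero]

theorem klCoeff_eq_zero_iff (w : W) (x : Hecke p) :
    klCoeff p w x = 0 ↔ (heckeBasis p).repr x w = 0 := by
  rw [klCoeff, LinearMap.smul_apply, Module.Basis.coord_apply, smul_eq_mul]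
  constructor
  · intro h
    have := congrArg (fun z => tp (-(p.weight w : ℤ)) * z) h
    simpa [← mul_assoc, ← LaurentPolynomial.T_add] using this
  · intro h; rw [h, mul_zero]

theorem klCoeff_Cs_mul (i : B) (n : ℕ) (x : Hecke p)
    (hx : ∀ y, klCoeff p y x ≠ 0 → cs.length y < n) (y : W)
    (hy : klCoeff p y (heckeCs p i * x) ≠ 0) : cs.length y < n + 1 := by
  classical
  have mem : ∀ (m : ℕ) (z : Hecke p),
      z ∈ Submodule.span ZT (heckeBasis p '' {w | cs.length w < m}) ↔
        ∀ y, klCoeff p y z ≠ 0 → cs.length y < m := by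
    intro m z
    rw [Module.Basis.mem_span_image]
    have e : ∀ y, klCoeff p y z ≠ 0 ↔ (heckeBasis p).repr z y ≠ 0 := fun y =>
      (klCoeff_eq_zero_iff p y z).not
    constructor
    · intro h y hy; exact h (Finset.mem_coe.2 (Finsupp.mem_support_iff.2 ((e y).1 hy)))
    · intro h y hy; exact h y ((e y).2 (Finsupp.mem_support_iff.1 (Finset.mem_coe.1 hy)))
  refine (mem (n + 1) _).1 ?_ y hy
  have hx' := (mem n x).2 hx
  clear hy hx
  have hb : ∀ (m : ℕ) (w : W), cs.length w < m → heckeT p w ∈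
      Submodule.span ZT (heckeBasis p '' {w | cs.length w < m}) := fun m w h =>
    Submodule.subset_span ⟨w, h, heckeBasis_apply p w⟩
  induction hx' using Submodule.span_induction with
  | mem x hx =>
    obtain ⟨w, hw, rfl⟩ := hx
    have hw' : cs.length w < n := hw
    rw [heckeBasis_apply, heckeCs, smul_mul_assoc, add_mul, one_mul]
    refine Submodule.smul_mem _ _ (add_mem ?_ (hb _ _ (by omega)))
    by_cases h : cs.IsLeftDescent w i
    · rw [heckeT_simple_mul_down p h]
      have : cs.length (cs.simple i * w) < cs.length w := h
      exact add_mem (Submodule.smul_mem _ _ (hb _ _ (by omega)))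
        (Submodule.smul_mem _ _ (hb _ _ (by omega)))
    · rw [heckeT_simple_mul_up p h]
      have := (cs.not_isLeftDescent_iff).1 h
      exact hb _ _ (by omega)
  | zero => rw [mul_zero]; exact zero_mem _
  | add x y _ _ hx hy => rw [mul_add]; exact add_mem hx hy
  | smul a x _ hx => rw [mul_smul_comm]; exact Submodule.smul_mem _ _ hx

/-- A bar-invariant element with leading term `w` and other terms of smaller length. -/
def IsKLTri (w : W) (x : Hecke p) : Prop :=
  IsKL p w x ∧ ∀ y, y ≠ w → klCoeff p y x ≠ 0 → cs.length y < cs.length w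

theorem exists_isKLTri_aux (K : W → Hecke p) (w : W)
    (hK : ∀ y, cs.length y < cs.length w → IsKLTri p y (K y)) (x : Hecke p)
    (hbar : heckeBar p x = x) (hw : klCoeff p w x = 1)
    (hlow : ∀ y, y ≠ w → klCoeff p y x ≠ 0 → cs.length y < cs.length w) (d : ℕ) :
    ∃ x, heckeBar p x = x ∧ klCoeff p w x = 1 ∧
      (∀ y, y ≠ w → klCoeff p y x ≠ 0 → cs.length y < cs.length w) ∧
      ∀ y, y ≠ w → cs.length w ≤ cs.length y + d → IsNegPart (klCoeff p y x) := by
  classical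
  induction d with
  | zero =>
    refine ⟨x, hbar, hw, hlow, fun y hy hl => ?_⟩
    by_contra hne
    have := hlow y hy (fun h => hne (h ▸ IsNegPart.zero))
    omega
  | succ d ih =>
    obtain ⟨x, hbar, hw, hlow, hneg⟩ := ih
    choose m hm hm' using exists_symm
    set F := ((heckeBasis p).repr x).support.filter
      (fun y => y ≠ w ∧ cs.length w = cs.length y + (d + 1)) with hF
    have hFl : ∀ y ∈ F, cs.length w = cs.length y + (d + 1) := fun y hy =>
      (Finset.mem_filter.1 hy).2.2
    have hKF : ∀ y ∈ F, IsKLTri p y (K y) := fun y hy => hK y (by have := hFl y hy; omega)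
    have hco : ∀ z, klCoeff p z (x - ∑ y ∈ F, m (klCoeff p y x) • K y) =
        klCoeff p z x - ∑ y ∈ F, m (klCoeff p y x) * klCoeff p z (K y) := by
      intro z; rw [map_sub, map_sum]; simp only [map_smul, smul_eq_mul]
    have hzero : ∀ z, cs.length w < cs.length z + (d + 1) →
        ∑ y ∈ F, m (klCoeff p y x) * klCoeff p z (K y) = 0 := by
      intro z hz
      refine Finset.sum_eq_zero fun y hy => ?_
      have h1 := hFl y hy
      by_cases h0 : klCoeff p z (K y) = 0
      · rw [h0, mul_zero]
      · have h2 := (hKF y hy).2 z (by rintro rfl; omega) h0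
        omega
    refine ⟨x - ∑ y ∈ F, m (klCoeff p y x) • K y, ?_, ?_, ?_, ?_⟩
    · rw [heckeBar_sub, heckeBar_sum, hbar]
      congr 1
      refine Finset.sum_congr rfl fun y hy => ?_
      rw [heckeBar_smul, hm, (hKF y hy).1.1]
    · rw [hco, hzero w (by omega), hw, sub_zero]
    · intro y hy hne
      by_contra hl
      apply hne
      rw [hco, hzero y (by omega), sub_zero]
      by_contra h
      exact hl (hlow y hy h)
    · intro z hz hl
      rw [hco]
      rcases Nat.lt_or_ge (cs.length w) (cs.length z + (d + 1)) with h | h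
      · rw [hzero z h, sub_zero]; exact hneg z hz (by omega)
      · have hs : ∀ y ∈ F, y ≠ z → m (klCoeff p y x) * klCoeff p z (K y) = 0 := by
          intro y hy hyz
          by_cases h0 : klCoeff p z (K y) = 0
          · rw [h0, mul_zero]
          · have h1 := (hKF y hy).2 z (Ne.symm hyz) h0
            have h2 := hFl y hy
            omega
        by_cases hzF : z ∈ F
        · rw [Finset.sum_eq_single_of_mem z hzF hs, (hKF z hzF).1.2.1, mul_one]
          exact hm' _
        · rw [Finset.sum_eq_zero fun y hy => hs y hy (by rintro rfl; exact hzF hy), sub_zero]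
          have h0 : klCoeff p z x = 0 := by
            by_contra h0
            apply hzF
            rw [hF, Finset.mem_filter, Finsupp.mem_support_iff]
            exact ⟨fun h => h0 ((klCoeff_eq_zero_iff p z x).2 h), hz, by omega⟩
          rw [h0]; exact IsNegPart.zero

theorem exists_isKLTri (w : W) : ∃ x, IsKLTri p w x := by
  classical
  induction hn : cs.length w using Nat.strong_induction_on generalizing w with
  | _ n ih =>
    subst hn
    by_cases hw1 : w = 1
    · subst hw1
      have h1 : ∀ y : W, klCoeff p y (1 : Hecke p) = if (1 : W) = y then 1 else 0 := by
        intro y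
        rw [← heckeT_one, klCoeff_T, p.weight_one]
        simp [tp]
      refine ⟨1, ⟨?_, by rw [h1]; simp, fun y hy => ?_⟩, fun y hy h => ?_⟩
      · rw [← heckeT_one, heckeBar_T]
        refine Units.inv_eq_of_mul_eq_one_right ?_
        rw [IsUnit.unit_spec, inv_one, heckeT_one, one_mul]
      · rw [h1, if_neg (Ne.symm hy)]; exact IsNegPart.zero
      · rw [h1, if_neg (Ne.symm hy)] at h; exact absurd rfl h
    obtain ⟨i, hi⟩ := cs.exists_leftDescent_of_ne_one hw1
    have hl := (cs.isLeftDescent_iff).1 hi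
    have hnd := (cs.isLeftDescent_iff_not_isLeftDescent_mul).1 hi
    choose! K hK using fun y (hy : cs.length y < cs.length w) => ih _ hy y rfl
    set u := cs.simple i * w with hu
    have hsu : cs.simple i * u = w := cs.simple_mul_simple_cancel_left i
    have hKu := hK u (by omega)
    have hwt : p.weight w = p.c i + p.weight u := by
      rw [← p.weight_simple_mul hnd, hsu]
    set r := K u - tp (-(p.weight u : ℤ)) • heckeT p u with hr
    have hrl : ∀ y, klCoeff p y r ≠ 0 → cs.length y < cs.length u := by
      intro y hy
      by_cases hyu : y = u
      · exfalso; apply hy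
        rw [hr, map_sub, map_smul, hyu, klCoeff_T, if_pos rfl, hKu.1.2.1, smul_eq_mul,
          ← LaurentPolynomial.T_add]
        simp
      · refine hKu.2 y hyu fun h => hy ?_
        rw [hr, map_sub, map_smul, klCoeff_T, if_neg (Ne.symm hyu), h, smul_zero, sub_zero]
    have hCr := klCoeff_Cs_mul p i _ r hrl
    have hco : ∀ y, klCoeff p y (heckeCs p i * K u) =
        tp (-(p.weight w : ℤ)) * ((if w = y then tp (p.weight w) else 0) +
          (if u = y then tp (p.weight u) else 0)) + klCoeff p y (heckeCs p i * r) := by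
      intro y
      have : K u = tp (-(p.weight u : ℤ)) • heckeT p u + r := by rw [hr]; abel
      rw [this, mul_add, map_add, mul_smul_comm, map_smul]
      congr 1
      rw [heckeCs, smul_mul_assoc, map_smul, add_mul, one_mul, heckeT_simple_mul_up p hnd, hsu,
        map_add, klCoeff_T, klCoeff_T, smul_eq_mul, smul_eq_mul, ← mul_assoc,
        ← LaurentPolynomial.T_add, hwt]
      congr 2
      push_cast; ring
    have hwu : w ≠ u := by intro h; rw [← h] at hl; omega
    obtain ⟨x, h1, h2, h3, h4⟩ := exists_isKLTri_aux p K w hK (heckeCs p i * K u)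
      (by rw [heckeBar_Cs_mul, hKu.1.1]) (by
        rw [hco, if_pos rfl, if_neg (Ne.symm hwu), add_zero, ← LaurentPolynomial.T_add,
          neg_add_cancel, LaurentPolynomial.T_zero, add_eq_left]
        by_contra h
        have := hCr w h
        omega) (by
        intro y hy hne
        by_cases hyu : u = y
        · rw [← hyu]; omega
        · rw [hco, if_neg (Ne.symm hy), if_neg hyu, add_zero, mul_zero, zero_add] at hne
          have := hCr y hne
          omega) (cs.length w)
    exact ⟨x, ⟨h1, h2, fun y hy => h4 y hy (by omega)⟩, h3⟩

theorem klCoeff_linearCombination {K : W → Hecke p} (hK : ∀ w, IsKLTri p w (K w))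
    {a : W →₀ ZT} {w : W} (hmax : ∀ y ∈ a.support, cs.length y ≤ cs.length w) :
    klCoeff p w (Finsupp.linearCombination ZT K a) = a w := by
  rw [Finsupp.linearCombination_apply, Finsupp.sum, map_sum]
  simp only [map_smul, smul_eq_mul]
  rw [Finset.sum_eq_single w, (hK w).1.2.1, mul_one]
  · intro y hy hyw
    by_cases h0 : klCoeff p w (K y) = 0
    · rw [h0, mul_zero]
    · have h1 := (hK y).2 w (Ne.symm hyw) h0
      have h2 := hmax y hy
      omega
  · intro h; rw [Finsupp.notMem_support_iff.1 h, zero_mul]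

theorem linearIndependent_of_isKLTri {K : W → Hecke p} (hK : ∀ w, IsKLTri p w (K w)) :
    LinearIndependent ZT K := by
  rw [linearIndependent_iff]
  intro a ha
  by_contra hne
  obtain ⟨w, hw, hmax⟩ := Finset.exists_max_image a.support cs.length
    (Finsupp.support_nonempty_iff.2 hne)
  have := klCoeff_linearCombination p hK hmax
  rw [ha, map_zero] at this
  exact (Finsupp.mem_support_iff.1 hw) this.symm

theorem span_of_isKLTri {K : W → Hecke p} (hK : ∀ w, IsKLTri p w (K w)) :
    ⊤ ≤ Submodule.span ZT (Set.range K) := by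
  classical
  have h : ∀ w, heckeT p w ∈ Submodule.span ZT (Set.range K) := by
    intro w
    induction hn : cs.length w using Nat.strong_induction_on generalizing w with
    | _ n ih =>
      subst hn
      set r := K w - tp (-(p.weight w : ℤ)) • heckeT p w with hr
      have hrm : r ∈ Submodule.span ZT (Set.range K) := by
        rw [← (heckeBasis p).linearCombination_repr r, Finsupp.linearCombination_apply]
        refine Submodule.sum_mem _ fun y hy => Submodule.smul_mem _ _ ?_
        rw [heckeBasis_apply]
        refine ih _ ?_ y rfl
        have hy' : klCoeff p y r ≠ 0 := fun h =>
          (Finsupp.mem_support_iff.1 hy) ((klCoeff_eq_zero_iff p y r).1 h)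
        by_cases hyw : y = w
        · exfalso; apply hy'
          rw [hr, map_sub, map_smul, hyw, klCoeff_T, if_pos rfl, (hK w).1.2.1, smul_eq_mul,
            ← LaurentPolynomial.T_add]
          simp
        · refine (hK w).2 y hyw fun h => hy' ?_
          rw [hr, map_sub, map_smul, klCoeff_T, if_neg (Ne.symm hyw), h, smul_zero, sub_zero]
      have : heckeT p w = tp (p.weight w) • (K w - r) := by
        rw [hr, sub_sub_cancel, smul_smul, ← LaurentPolynomial.T_add]
        simp
      rw [this]
      exact Submodule.smul_mem _ _ (sub_mem (Submodule.subset_span ⟨w, rfl⟩) hrm)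
  rw [← (heckeBasis p).span_eq, Submodule.span_le]
  rintro _ ⟨w, rfl⟩
  rw [heckeBasis_apply]; exact h w

theorem existsUnique_isKL (w : W) : ∃! x, IsKL p w x := by
  choose K hK using exists_isKLTri p
  refine ⟨K w, (hK w).1, fun x hx => ?_⟩
  let b : Module.Basis W ZT (Hecke p) :=
    Module.Basis.mk (linearIndependent_of_isKLTri p hK) (span_of_isKLTri p hK)
  by_contra hne
  set z := x - K w with hz
  have hz0 : b.repr z ≠ 0 := by
    rw [Ne, LinearEquiv.map_eq_zero_iff]; exact sub_ne_zero.2 hne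
  have hneg : ∀ y, IsNegPart (klCoeff p y z) := by
    intro y n hn
    rw [hz, map_sub, AddMonoidAlgebra.coeff_sub, Finsupp.sub_apply]
    by_cases hy : y = w
    · rw [hy, hx.2.1, (hK w).1.2.1, sub_self]
    · rw [hx.2.2 y hy n hn, (hK w).1.2.2 y hy n hn, sub_self]
  have hzb : heckeBar p z = z := by rw [hz, heckeBar_sub, hx.1, (hK w).1.1]
  have hlc : Finsupp.linearCombination ZT K (b.repr z) = z := by
    conv_rhs => rw [← b.linearCombination_repr z]
    congr 1
    congr 1
    funext y
    exact (Module.Basis.mk_apply _ _ _).symm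
  have hsym : ∀ y, LaurentPolynomial.invert (b.repr z y) = b.repr z y := by
    intro y
    have h1 : z = ∑ y ∈ (b.repr z).support, LaurentPolynomial.invert (b.repr z y) • b y := by
      conv_lhs => rw [← hzb, ← hlc, Finsupp.linearCombination_apply, Finsupp.sum, heckeBar_sum]
      refine Finset.sum_congr rfl fun y _ => ?_
      rw [heckeBar_smul, (hK y).1.1, Module.Basis.mk_apply]
    have h2 := congrArg (fun v => b.repr v y) h1
    simp only [map_sum, map_smul, Module.Basis.repr_self, Finsupp.coe_finsetSum,
      Finset.sum_apply, Finsupp.smul_single, smul_eq_mul, mul_one] at h2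
    by_cases hy : y ∈ (b.repr z).support
    · rw [Finset.sum_eq_single_of_mem y hy (fun u _ hu => by
        exact Finsupp.single_eq_of_ne (Ne.symm hu)), Finsupp.single_eq_same] at h2
      exact h2.symm
    · rw [Finsupp.notMem_support_iff.1 hy, map_zero]
  obtain ⟨y, hy, hmax⟩ := Finset.exists_max_image (b.repr z).support cs.length
    (Finsupp.support_nonempty_iff.2 hz0)
  have h := klCoeff_linearCombination p hK hmax
  rw [hlc] at h
  apply Finsupp.mem_support_iff.1 hy
  have hn := hneg y
  rw [h] at hn
  ext n
  rcases le_or_gt 0 n with h0 | h0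
  · rw [hn n h0]; simp
  · rw [← hsym y, LaurentPolynomial.invert_apply, hn (-n) (by omega)]; simp

/-- The Kazhdan–Lusztig basis element `C'_w`. -/
noncomputable def klElt (w : W) : Hecke p := (existsUnique_isKL p w).choose

theorem klElt_spec (w : W) : IsKL p w (klElt p w) := (existsUnique_isKL p w).choose_spec.1

theorem klElt_isKLTri (w : W) : IsKLTri p w (klElt p w) := by
  obtain ⟨x, hx⟩ := exists_isKLTri p w
  rwa [(existsUnique_isKL p w).unique (klElt_spec p w) hx.1]

/-- The Kazhdan–Lusztig basis `(C'_w)` of the generic Hecke algebra. -/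
noncomputable def klBasis : Module.Basis W ZT (Hecke p) :=
  Module.Basis.mk (linearIndependent_of_isKLTri p (klElt_isKLTri p))
    (span_of_isKLTri p (klElt_isKLTri p))

@[simp] theorem klBasis_apply (w : W) : klBasis p w = klElt p w := Module.Basis.mk_apply _ _ _

end KL

section Cells

variable {B W : Type*} [Group W] {M : CoxeterMatrix B} {cs : CoxeterSystem M W}
  (p : HeckeParam cs)

/-- The structure constant `h_{x,y,z}`: the coefficient of `C'_z` in `C'_x C'_y`. -/
noncomputable def klStruct (x y z : W) : ZT := (klBasis p).repr (klElt p x * klElt p y) z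

/-- The Kazhdan–Lusztig left preorder `z ≤_L y`, generated by `h_{x,y,z} ≠ 0` for some `x`. -/
def LeL (z y : W) : Prop := Relation.ReflTransGen (fun z y => ∃ x, klStruct p x y z ≠ 0) z y

/-- The left cells: equivalence classes of `z ≤_L y ∧ y ≤_L z`. -/
def IsLeftCell (ω : Set W) : Prop := ∃ w, ω = {y | LeL p y w ∧ LeL p w y}

/-- For `I ⊆ W` closed downwards under `≤_L`, the left ideal of the Hecke algebra which is the
`ℤ[t, t⁻¹]`-span of the `C'_y`, `y ∈ I`. -/
noncomputable def klIdeal (I : Set W) (hI : ∀ z y, LeL p z y → y ∈ I → z ∈ I) :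
    Submodule (Hecke p) (Hecke p) where
  __ := (Submodule.span ZT (klElt p '' I)).toAddSubmonoid
  smul_mem' := by
    intro h m hm
    change h * m ∈ Submodule.span ZT (klElt p '' I)
    change m ∈ Submodule.span ZT (klElt p '' I) at hm
    induction hm using Submodule.span_induction with
    | zero => rw [mul_zero]; exact zero_mem _
    | add a b _ _ ha hb => rw [mul_add]; exact add_mem ha hb
    | smul a x _ hx => rw [mul_smul_comm]; exact Submodule.smul_mem _ _ hx
    | mem m hm =>
      obtain ⟨y, hy, rfl⟩ := hm
      rw [← (klBasis p).linearCombination_repr h, Finsupp.linearCombination_apply, Finsupp.sum,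
        Finset.sum_mul]
      refine Submodule.sum_mem _ fun x _ => ?_
      rw [smul_mul_assoc, klBasis_apply]
      refine Submodule.smul_mem _ _ ?_
      rw [← (klBasis p).linearCombination_repr (klElt p x * klElt p y),
        Finsupp.linearCombination_apply, Finsupp.sum]
      refine Submodule.sum_mem _ fun z hz => Submodule.smul_mem _ _ ?_
      rw [klBasis_apply]
      exact Submodule.subset_span
        ⟨z, hI z y (Relation.ReflTransGen.single ⟨x, Finsupp.mem_support_iff.1 hz⟩) hy, rfl⟩

/-- The left ideal `H^{≤_L ω}`, spanned by the `C'_y` with `y ≤_L ω`. -/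
noncomputable def idealLE (ω : Set W) : Submodule (Hecke p) (Hecke p) :=
  klIdeal p {y | ∃ w ∈ ω, LeL p y w}
    (by rintro z y hz ⟨w, hw, hy⟩; exact ⟨w, hw, hz.trans hy⟩)

/-- The left ideal `H^{<_L ω}`, spanned by the `C'_y` with `y <_L ω`. -/
noncomputable def idealLT (ω : Set W) : Submodule (Hecke p) (Hecke p) :=
  klIdeal p {y | ∃ w ∈ ω, LeL p y w ∧ ¬ LeL p w y} (by
    rintro z y hz ⟨w, hw, hy, hy'⟩
    exact ⟨w, hw, hz.trans hy, fun h => hy' (h.trans hz)⟩)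

/-- The left cell module `S(ω) = H^{≤_L ω} / H^{<_L ω}`, a left module. -/
abbrev cellModule (ω : Set W) : Type _ :=
  (idealLE p ω) ⧸ (idealLT p ω).submoduleOf (idealLE p ω)

end Cells

section BaseChange

open TensorProduct

variable (R : Type*) [CommRing R] [Algebra ZT R]
variable {B W : Type*} [Group W] {M : CoxeterMatrix B} {cs : CoxeterSystem M W}
  (p : HeckeParam cs)

/-- The Hecke algebra `H_R = H ⊗ R` over a `ℤ[t, t⁻¹]`-algebra `R`. -/
abbrev HeckeOver : Type _ := R ⊗[ZT] Hecke p

/-- The left action of `H_R` on the base-changed left cell module `S_R(ω) = S(ω) ⊗ R`. -/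
noncomputable def cellAction (ω : Set W) :
    HeckeOver R p →ₐ[R] Module.End R (R ⊗[ZT] cellModule p ω) :=
  Algebra.TensorProduct.lift (Algebra.ofId R _)
    ((Module.End.baseChangeHom ZT R (cellModule p ω)).comp
      (Algebra.lsmul ZT ZT (cellModule p ω)))
    (fun r _ => Algebra.commutes r _)

theorem cellAction_tmul (ω : Set W) (r r' : R) (h : Hecke p) (m : cellModule p ω) :
    cellAction R p ω (r ⊗ₜ h) (r' ⊗ₜ m) = (r * r') ⊗ₜ (h • m) := by
  exact (LinearMap.congr_fun (Algebra.TensorProduct.lift_tmul _ _ _ r h) (r' ⊗ₜ m)).trans rfl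

/-- The dual left cell module `S_{ω,R} = Hom_R(S_R(ω), R)`. -/
def DualCell (ω : Set W) : Type _ := Module.Dual R (R ⊗[ZT] cellModule p ω)

noncomputable instance (ω : Set W) : AddCommGroup (DualCell R p ω) :=
  inferInstanceAs (AddCommGroup (Module.Dual R (R ⊗[ZT] cellModule p ω)))

/-- The right action of `H_R` on the dual left cell module: `(f · a) x = f (a x)`. -/
noncomputable instance (ω : Set W) : Module (HeckeOver R p)ᵐᵒᵖ (DualCell R p ω) where
  smul a f := LinearMap.comp (show Module.Dual R (R ⊗[ZT] cellModule p ω) from f)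
    (cellAction R p ω a.unop)
  one_smul f := LinearMap.ext fun x => by
    change (show Module.Dual R _ from f) (cellAction R p ω 1 x) = _
    rw [map_one]; rfl
  mul_smul a b f := LinearMap.ext fun x => by
    change (show Module.Dual R _ from f) (cellAction R p ω (b.unop * a.unop) x) = _
    rw [map_mul]; rfl
  smul_zero a := rfl
  smul_add a f g := rfl
  add_smul a b f := LinearMap.ext fun x => by
    change (show Module.Dual R _ from f) (cellAction R p ω (a.unop + b.unop) x) = _
    rw [map_add]; exact map_add (show Module.Dual R _ from f) _ _
  zero_smul f := LinearMap.ext fun x => by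
    change (show Module.Dual R _ from f) (cellAction R p ω 0 x) = _
    rw [map_zero]; exact map_zero (show Module.Dual R _ from f)

/-- The element `x_λ = ∑_{w ∈ W_λ} T_w` of `H_R`, where `W_λ` is the parabolic subgroup generated
by `λ` (`W` finite). -/
noncomputable def xElt (J : Set B) : HeckeOver R p :=
  (1 : R) ⊗ₜ[ZT] ∑ᶠ w ∈ (Subgroup.closure (cs.simple '' J) : Set W), heckeT p w

/-- The right ideal `x_λ H_R` of `H_R`, as a right module. -/
noncomputable def xIdeal (J : Set B) : Submodule (HeckeOver R p)ᵐᵒᵖ (HeckeOver R p) :=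
  Submodule.span (HeckeOver R p)ᵐᵒᵖ {xElt R p J}

end BaseChange

end HeckeCell

/-! Let `τ` be the symmetrizing trace, the coefficient at `T_1`. Since `T_w` and `T_{w⁻¹}` are dual
under `τ` up to a unit, composing with `τ` identifies `H_R`-maps `ρ : E → x_J H_R` with linear forms
`φ : E → R` satisfying `φ(e T_s) = q_s φ(e)` for `s ∈ J`, where `q_s = q^{c_s}`
(`exists_hom_xIdeal`, `traceOver_mul_simple`, `traceOver_nondegenerate`). Call such forms
equivariant. By the long exact sequence, the vanishing of `Ext¹` follows once every map `α : K → x_J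
H_R` on the kernel `K` of a surjection `π : E → S_{ω,R}` extends to `E`, that is, once an
equivariant form on `K` extends to an equivariant form on `E` (`exists_extend_to_xIdeal`).

The dual cell module is free over `R`, so the form on `K` extends to an `R`-linear form `φ₀` on `E`,
perhaps not equivariant. Semisimplicity of `H_F` supplies an equivariant `F`-valued form `φF` with
the same restriction to `K` (`exists_form_extending`). The difference `φ₀ - φF` factors as `χ ∘ π`,
and the denominators of `χ` must be controlled.

For this let `b_y`, `y ∈ ω`, be dual to the Kazhdan–Lusztig basis of the cell module. If `sy > y`
then `b_y T_s = -b_y`; if `sy < y` then the coordinate at `y` of `f T_s` is `q_s` times that of `f`.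
Both reflect the action of `T_s` on the `C'_y` (`heckeT_simple_mul_klElt`,
`klBasis_repr_simple_mul`). In the first case, with `s ∈ J`, evaluating `χ` on `b_y T_s` gives `(q_s
+ 1) χ(b_y) ∈ R`, hence `χ(b_y) ∈ R`. Let `ψ : S_{ω,R} → R` agree with `χ` on these `b_y` and vanish
on the others. Then `χ - ψ` kills all `f T_s - q_s f`, whose coordinates live on the `y` with `sy >
y`. So `φ₀ - ψ ∘ π = φF + (χ - ψ) ∘ π` is both `R`-valued and equivariant, and agrees with `φ₀` on
`K`. -/

namespace HeckeCell

/-! ### Inversions and minimal coset representatives. -/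

section CoxeterLength

variable {B W : Type*} [Group W] {M : CoxeterMatrix B} (cs : CoxeterSystem M W)

/-- The cocycle rule for inversion sets: `invHom` is an action that conjugates the first coordinate,
and the increments in the second coordinate add up. -/
theorem invParity_mul (v w x : W) :
    invParity cs (v * w) x = invParity cs w x + invParity cs v (w * x * w⁻¹) := by
  classical
  obtain ⟨ω, rfl⟩ := cs.wordProd_surjective v
  obtain ⟨ω', rfl⟩ := cs.wordProd_surjective w
  simp only [invParity]
  rw [invHom_mul_apply, invHom_wordProd, invHom_wordProd, invHom_wordProd]
  simp

theorem length_mul_lt_of_invParity {w x : W} (h : invParity cs w x = 1) :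
    cs.length (w * x) < cs.length w := by
  obtain ⟨ω, hω, rfl⟩ := cs.exists_isReduced w
  exact (cs.isRightInversion_of_mem_rightInvSeq hω ((mem_rightInvSeq_iff cs hω _).2 h)).2

/-- The parabolic subgroup generated by the simple reflections in `J`. -/
abbrev parabolic (J : Set B) : Subgroup W := Subgroup.closure (cs.simple '' J)

/-- Lengths add along a coset `W_J d` with `d` of minimal length. This makes `x_J T_d` the sum of
the `T_w` over the coset. -/
theorem length_parabolic_mul {J : Set B} {d : W}
    (hd : ∀ u ∈ parabolic cs J, cs.length d ≤ cs.length (u * d)) {w : W}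
    (hw : w ∈ parabolic cs J) : cs.length (w * d) = cs.length w + cs.length d := by
  have step : ∀ i ∈ J, ∀ w ∈ parabolic cs J, cs.length (w * d) = cs.length w + cs.length d →
      cs.length (cs.simple i * w * d) = cs.length (cs.simple i * w) + cs.length d := by
    intro i hi w hw ih
    rw [mul_assoc]
    by_cases h : cs.IsLeftDescent w i
    · have h1 := (cs.isLeftDescent_iff).1 h
      have h2 := cs.length_mul_le (cs.simple i * w) d
      have h3 := cs.length_simple_mul (w * d) i
      rw [mul_assoc] at h2
      omega
    · have h1 := (cs.not_isLeftDescent_iff).1 h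
      have h2 : ¬ cs.IsLeftDescent (w * d) i := by
        -- If `s` were a left descent of `wd` but not of `w`, the cocycle rule would make `w⁻¹sw` an
        -- inversion of `d⁻¹`, so `(w⁻¹sw)d` would be shorter than `d` in the same coset.
        intro h2
        rw [← cs.isRightDescent_inv_iff, isRightDescent_iff_invParity, mul_inv_rev,
          invParity_mul] at h2
        rw [← cs.isRightDescent_inv_iff, isRightDescent_iff_invParity] at h
        have h0 : ∀ a b : ZMod 2, a + b = 1 → a ≠ 1 → b = 1 := by decide
        have h3 := length_mul_lt_of_invParity cs (h0 _ _ h2 h)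
        rw [← cs.length_inv, ← cs.length_inv d⁻¹] at h3
        have h4 := hd (w⁻¹ * cs.simple i * w)
          (mul_mem (mul_mem (inv_mem hw) (Subgroup.subset_closure ⟨i, hi, rfl⟩)) hw)
        simp [mul_assoc] at h3 h4
        omega
      have h3 := (cs.not_isLeftDescent_iff).1 h2
      omega
  induction hw using Subgroup.closure_induction_left with
  | one => simp
  | mul_left x hx w hw ih =>
    obtain ⟨i, hi, rfl⟩ := hx
    exact step i hi w hw ih
  | inv_mul_cancel x hx w hw ih =>
    obtain ⟨i, hi, rfl⟩ := hx
    rw [cs.inv_simple]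
    exact step i hi w hw ih

variable {cs} in
theorem HeckeParam.weight_inv (p : HeckeParam cs) (w : W) : p.weight w⁻¹ = p.weight w := by
  obtain ⟨ω, hω, rfl⟩ := cs.exists_isReduced w
  rw [← cs.wordProd_reverse, p.weight_eq hω, p.weight_eq hω.reverse, List.map_reverse,
    List.sum_reverse]

end CoxeterLength

/-! ### Standard basis: products, coordinates and the trace. -/

section StandardBasis

variable {B W : Type*} [Group W] {M : CoxeterMatrix B} {cs : CoxeterSystem M W}
  (p : HeckeParam cs)

theorem heckeT_mul_of_length_add {v w : W} (h : cs.length (v * w) = cs.length v + cs.length w) :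
    heckeT p v * heckeT p w = heckeT p (v * w) := by
  induction hn : cs.length v generalizing v with
  | zero => rw [cs.length_eq_zero_iff] at hn; rw [hn, heckeT_one, one_mul, one_mul]
  | succ n ih =>
    obtain ⟨i, hi⟩ := cs.exists_leftDescent_of_ne_one (w := v) (by rintro rfl; simp at hn)
    have hl := (cs.isLeftDescent_iff).1 hi
    have hnd := (cs.isLeftDescent_iff_not_isLeftDescent_mul).1 hi
    have e : heckeT p v = heckeT p (cs.simple i) * heckeT p (cs.simple i * v) := by
      rw [heckeT_simple_mul_up p hnd, cs.simple_mul_simple_cancel_left]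
    have h2 := cs.length_mul_le (cs.simple i * v) w
    have h3 := cs.length_simple_mul (v * w) i
    rw [mul_assoc] at h2
    rw [e, mul_assoc, ih (v := cs.simple i * v) (by rw [mul_assoc]; omega) (by omega),
      heckeT_simple_mul_up p, mul_assoc, cs.simple_mul_simple_cancel_left]
    rw [CoxeterSystem.IsLeftDescent, mul_assoc, cs.simple_mul_simple_cancel_left]
    omega

/-- The span of `T_w` and `T_{sw}` is stable under left multiplication by `T_s`; these are the two
rows of the resulting 2×2 matrix. -/
theorem heckeT_simple_mul_repr (i : B) {w : W} (hw : ¬ cs.IsLeftDescent w i) (h : Hecke p) :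
    (heckeBasis p).repr (heckeT p (cs.simple i) * h) w =
        p.q i * (heckeBasis p).repr h (cs.simple i * w) ∧
      (heckeBasis p).repr (heckeT p (cs.simple i) * h) (cs.simple i * w) =
        (heckeBasis p).repr h w + (p.q i - 1) * (heckeBasis p).repr h (cs.simple i * w) := by
  classical
  have hr : ∀ v, (heckeBasis p).repr (heckeT p v) = Finsupp.single v 1 := fun v => by
    rw [← heckeBasis_apply, Module.Basis.repr_self]
  induction h using hecke_induction with
  | hadd x y hx hy =>
    rw [mul_add, map_add, map_add, Finsupp.add_apply, Finsupp.add_apply, Finsupp.add_apply,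
      Finsupp.add_apply, hx.1, hx.2, hy.1, hy.2]
    constructor <;> ring
  | hsmul a x hx =>
    rw [mul_smul_comm, map_smul, map_smul, Finsupp.smul_apply, Finsupp.smul_apply,
      Finsupp.smul_apply, Finsupp.smul_apply, hx.1, hx.2]
    simp only [smul_eq_mul]
    constructor <;> ring
  | hT v =>
    have hw' : cs.IsLeftDescent (cs.simple i * w) i := by
      rw [cs.isLeftDescent_iff_not_isLeftDescent_mul, cs.simple_mul_simple_cancel_left]; exact hw
    have hinj : ∀ a b : W, cs.simple i * a = b ↔ a = cs.simple i * b := fun a b => by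
      constructor
      · rintro rfl; rw [cs.simple_mul_simple_cancel_left]
      · rintro rfl; rw [cs.simple_mul_simple_cancel_left]
    by_cases hv : cs.IsLeftDescent v i
    · have hne : v ≠ w := by rintro rfl; exact hw hv
      rw [heckeT_simple_mul_down p hv]
      simp only [map_add, map_smul, hr, Finsupp.add_apply, Finsupp.smul_apply, smul_eq_mul,
        Finsupp.single_apply, hne, if_false, hinj, cs.simple_mul_simple_cancel_left]
      constructor <;> ring
    · have hne : v ≠ cs.simple i * w := by rintro rfl; exact hv hw'
      rw [heckeT_simple_mul_up p hv]
      simp only [hr, Finsupp.single_apply, hne, if_false, hinj, cs.simple_mul_simple_cancel_left]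
      constructor <;> ring

/-- The symmetrizing trace: the coefficient at `T_1`. -/
noncomputable def heckeTrace : Hecke p →ₗ[ZT] ZT := (heckeBasis p).coord 1

open scoped Classical in
theorem heckeTrace_T (w : W) : heckeTrace p (heckeT p w) = if w = 1 then 1 else 0 := by
  rw [heckeTrace, Module.Basis.coord_apply, ← heckeBasis_apply, Module.Basis.repr_self,
    Finsupp.single_apply]

-- Duality of `T_v` and `T_{v⁻¹}` up to the unit `t^{2L(v)}`, by moving the last letter `s` of `v`
-- over to `w`. If `sw < w`, the extra term `T_w` has trace zero against `T_{vs}`, since `(vs)w = 1`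
-- would force `sw` to be longer than `w`.
open scoped Classical in
theorem heckeTrace_T_mul_T (v w : W) : heckeTrace p (heckeT p v * heckeT p w) =
    if v * w = 1 then tp (2 * (p.weight v : ℤ)) else 0 := by
  induction hn : cs.length v generalizing v w with
  | zero =>
    rw [cs.length_eq_zero_iff] at hn
    subst hn
    rw [heckeT_one, one_mul, one_mul, heckeTrace_T, p.weight_one]
    simp [tp]
  | succ n ih =>
    obtain ⟨i, hi⟩ := cs.exists_rightDescent_of_ne_one (w := v) (by rintro rfl; simp at hn)
    have hl := (cs.isRightDescent_iff).1 hi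
    set v' := v * cs.simple i with hv'
    have hv : v = v' * cs.simple i := (cs.simple_mul_simple_cancel_right i).symm
    have hc : p.weight v = p.c i + p.weight v' := by
      rw [← p.weight_inv v, ← p.weight_inv v', hv, mul_inv_rev, cs.inv_simple]
      refine p.weight_simple_mul ?_
      rw [cs.not_isLeftDescent_iff, ← cs.inv_simple, ← mul_inv_rev, ← hv, cs.length_inv,
        cs.length_inv]
      omega
    have e : heckeT p v = heckeT p v' * heckeT p (cs.simple i) := by
      rw [heckeT_mul_simple_up p (by rw [← hv]; omega), ← hv]
    have key : v' * (cs.simple i * w) = 1 ↔ v * w = 1 := by rw [← mul_assoc, ← hv]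
    by_cases hw : cs.IsLeftDescent w i
    · have h0 : v' * w ≠ 1 := by
        intro h
        have h1 := eq_inv_of_mul_eq_one_right h
        have h2 := (cs.isLeftDescent_iff).1 hw
        rw [h1, ← cs.inv_simple, ← mul_inv_rev, ← hv, cs.length_inv, cs.length_inv] at h2
        omega
      rw [e, mul_assoc, heckeT_simple_mul_down p hw, mul_add, mul_smul_comm, mul_smul_comm,
        map_add, map_smul, map_smul, ih _ _ (by omega), ih _ _ (by omega), if_neg h0, smul_zero,
        add_zero]
      simp only [key]
      split_ifs
      · rw [smul_eq_mul, HeckeParam.q, ← LaurentPolynomial.T_add, hc]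
        congr 1
        push_cast; ring
      · rw [smul_zero]
    · have h0 : v * w ≠ 1 := by
        intro h
        have h1 : cs.simple i * w = v'⁻¹ := eq_inv_of_mul_eq_one_right (key.2 h)
        have h2 := (cs.not_isLeftDescent_iff).1 hw
        have h3 := eq_inv_of_mul_eq_one_right h
        rw [h1, h3, cs.length_inv, cs.length_inv] at h2
        omega
      rw [e, mul_assoc, heckeT_simple_mul_up p hw, ih _ _ (by omega), if_neg h0, if_neg]
      rwa [key]

end StandardBasis
-- Action of `T_s` in the Kazhdan–Lusztig basis.
section KLDescent

variable {B W : Type*} [Group W] {M : CoxeterMatrix B} {cs : CoxeterSystem M W}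
  (p : HeckeParam cs)

theorem IsNegPart.add {a b : ZT} (ha : IsNegPart a) (hb : IsNegPart b) : IsNegPart (a + b) :=
  fun n hn => by rw [AddMonoidAlgebra.coeff_add, Finsupp.add_apply, ha n hn, hb n hn, add_zero]

theorem IsNegPart.neg {a : ZT} (ha : IsNegPart a) : IsNegPart (-a) :=
  fun n hn => by rw [AddMonoidAlgebra.coeff_neg, Finsupp.neg_apply, ha n hn, neg_zero]

theorem coeff_tp_mul (k n : ℤ) (a : ZT) : (tp k * a).coeff n = a.coeff (n - k) := by
  rw [tp, LaurentPolynomial.T, AddMonoidAlgebra.coeff_single_mul_eq_mul_coeff (n - k), one_mul]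
  intro m _
  constructor <;> intro h <;> omega

theorem IsNegPart.tp_mul {a : ZT} (ha : IsNegPart a) {k : ℤ} (hk : k ≤ 0) :
    IsNegPart (tp k * a) :=
  fun n hn => by rw [coeff_tp_mul, ha _ (by omega)]

theorem isNegPart_tp {k : ℤ} (hk : k < 0) : IsNegPart (tp k) := fun n hn => by
  rw [LaurentPolynomial.T_apply, if_neg (by omega)]

theorem IsNegPart.eq_zero_of_invert {a : ZT} (ha : IsNegPart a)
    (h : LaurentPolynomial.invert a = a) : a = 0 := by
  ext n
  rcases le_or_gt 0 n with h0 | h0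
  · rw [ha n h0]; simp
  · rw [← h, LaurentPolynomial.invert_apply, ha (-n) (by omega)]; simp

theorem tp_mul_eq_zero {k : ℤ} {a : ZT} (h : tp k * a = 0) : a = 0 := by
  have := congrArg (fun z => tp (-k) * z) h
  simpa [← mul_assoc, ← LaurentPolynomial.T_add] using this

theorem linearCombination_klElt_repr (h : Hecke p) :
    Finsupp.linearCombination ZT (klElt p) ((klBasis p).repr h) = h := by
  conv_rhs => rw [← (klBasis p).linearCombination_repr h]
  congr 2
  funext y
  exact (klBasis_apply p y).symm

/-- By triangularity, at an element `y` of maximal length in the Kazhdan–Lusztig support, the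
normalized standard coefficient is the Kazhdan–Lusztig coordinate. The arguments below compare the
two descriptions of this leading coefficient. -/
theorem exists_max_klCoeff {h : Hecke p} (hh : h ≠ 0) :
    ∃ y, (klBasis p).repr h y ≠ 0 ∧ klCoeff p y h = (klBasis p).repr h y ∧
      ∀ v, cs.length y < cs.length v → klCoeff p v h = 0 := by
  have h0 : (klBasis p).repr h ≠ 0 := by rwa [Ne, LinearEquiv.map_eq_zero_iff]
  obtain ⟨y, hy, hmax⟩ := Finset.exists_max_image ((klBasis p).repr h).support cs.length
    (Finsupp.support_nonempty_iff.2 h0)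
  have key : ∀ v, cs.length y ≤ cs.length v → klCoeff p v h = (klBasis p).repr h v := by
    intro v hv
    have := klCoeff_linearCombination p (klElt_isKLTri p) (a := (klBasis p).repr h) (w := v)
      (fun u hu => (hmax u hu).trans hv)
    rwa [linearCombination_klElt_repr] at this
  refine ⟨y, Finsupp.mem_support_iff.1 hy, key y le_rfl, fun v hv => ?_⟩
  rw [key v hv.le]
  by_contra hne
  have := hmax v (Finsupp.mem_support_iff.2 hne)
  omega

theorem invert_klBasis_repr {h : Hecke p} (hh : heckeBar p h = h) (y : W) :
    LaurentPolynomial.invert ((klBasis p).repr h y) = (klBasis p).repr h y := by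
  classical
  have h1 : h = ∑ y ∈ ((klBasis p).repr h).support,
      LaurentPolynomial.invert ((klBasis p).repr h y) • klBasis p y := by
    conv_lhs => rw [← hh, ← linearCombination_klElt_repr p h, Finsupp.linearCombination_apply,
      Finsupp.sum, heckeBar_sum]
    refine Finset.sum_congr rfl fun y _ => ?_
    rw [heckeBar_smul, (klElt_spec p y).1, klBasis_apply]
  have h2 := congrArg (fun v => (klBasis p).repr v y) h1
  simp only [map_sum, map_smul, Module.Basis.repr_self, Finsupp.coe_finsetSum,
    Finset.sum_apply, Finsupp.smul_single, smul_eq_mul, mul_one] at h2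
  by_cases hy : y ∈ ((klBasis p).repr h).support
  · rw [Finset.sum_eq_single_of_mem y hy (fun u _ hu => by
      exact Finsupp.single_eq_of_ne (Ne.symm hu)), Finsupp.single_eq_same] at h2
    exact h2.symm
  · rw [Finsupp.notMem_support_iff.1 hy, map_zero]

theorem klCoeff_simple_mul (i : B) {w : W} (hw : ¬ cs.IsLeftDescent w i) (h : Hecke p) :
    klCoeff p w (heckeT p (cs.simple i) * h) = tp (p.c i) * klCoeff p (cs.simple i * w) h ∧
      klCoeff p (cs.simple i * w) (heckeT p (cs.simple i) * h) =
        tp (p.c i) * klCoeff p w h + (p.q i - 1) * klCoeff p (cs.simple i * w) h := by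
  obtain ⟨h1, h2⟩ := heckeT_simple_mul_repr p i hw h
  simp only [klCoeff, LinearMap.smul_apply, Module.Basis.coord_apply, h1, h2, smul_eq_mul,
    p.weight_simple_mul hw, HeckeParam.q]
  push_cast
  constructor
  · rw [← mul_assoc, ← mul_assoc, ← LaurentPolynomial.T_add, ← LaurentPolynomial.T_add]
    congr 2
    ring
  · rw [show tp ((p.c i : ℤ) + p.weight w) = tp (p.c i) * tp (p.weight w) from
      LaurentPolynomial.T_add _ _]
    ring

theorem heckeT_simple_mul_self_mul (i : B) (h : Hecke p) :
    heckeT p (cs.simple i) * (heckeT p (cs.simple i) * h) =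
      p.q i • h + (p.q i - 1) • (heckeT p (cs.simple i) * h) := by
  have h1 := heckeT_simple_mul_down p (i := i) (w := cs.simple i)
    (by rw [CoxeterSystem.IsLeftDescent, cs.simple_mul_simple_self]; simp)
  rw [cs.simple_mul_simple_self, heckeT_one] at h1
  rw [← mul_assoc, h1, add_mul, smul_mul_assoc, smul_mul_assoc, one_mul]

theorem q_eq (i : B) : p.q i = tp (p.c i) * tp (p.c i) := by
  rw [HeckeParam.q, ← LaurentPolynomial.T_add, two_mul]

theorem tp_neg_mul_tp (k : ℤ) : tp (-k) * tp k = 1 := by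
  rw [← LaurentPolynomial.T_add, neg_add_cancel, LaurentPolynomial.T_zero]

/-- The defect `d = t^{-c_s} T_s C'_z - t^{c_s} C'_z` is bar invariant and satisfies `T_s d = -d`.
Consider its leading coefficient, at `y`. If `sy < y`, it lies in `t⁻¹ℤ[t⁻¹]` and is fixed by `t ↦
t⁻¹`, so it is zero. If `sy > y`, then `T_s d = -d` makes it a multiple of the coefficient at `sy`,
which is zero by maximality. Hence `d = 0`. -/
theorem heckeT_simple_mul_klElt {i : B} {z : W} (hz : cs.IsLeftDescent z i) :
    heckeT p (cs.simple i) * klElt p z = p.q i • klElt p z := by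
  have hpos : (0 : ℤ) < p.c i := by exact_mod_cast p.pos i
  have hcc := tp_neg_mul_tp (p.c i)
  set d := tp (-(p.c i : ℤ)) • (heckeT p (cs.simple i) * klElt p z)
    - tp (p.c i) • klElt p z with hd
  have hbar : heckeBar p d = d := by
    have e : d = heckeCs p i * klElt p z
        - (tp (p.c i) + tp (-(p.c i : ℤ)) : ZT) • klElt p z := by
      rw [hd, heckeCs, smul_mul_assoc, add_mul, one_mul]
      module
    rw [e, heckeBar_sub, heckeBar_Cs_mul, heckeBar_smul, (klElt_spec p z).1, map_add,
      LaurentPolynomial.invert_T, LaurentPolynomial.invert_T, neg_neg, add_comm (tp _)]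
  have hTd : heckeT p (cs.simple i) * d = -d := by
    rw [hd, mul_sub, mul_smul_comm, mul_smul_comm, heckeT_simple_mul_self_mul, q_eq]
    set x := heckeT p (cs.simple i) * klElt p z
    have e : tp (-(p.c i : ℤ)) • (tp (p.c i) * tp (p.c i) : ZT) • klElt p z =
        tp (p.c i) • klElt p z := by rw [smul_smul, ← mul_assoc, hcc, one_mul]
    have e2 : tp (-(p.c i : ℤ)) • (tp (p.c i) * tp (p.c i) : ZT) • x = tp (p.c i) • x := by
      rw [smul_smul, ← mul_assoc, hcc, one_mul]
    rw [smul_add, sub_smul, smul_sub, one_smul, e, e2]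
    module
  have hd0 : d = 0 := by
    by_contra hne
    obtain ⟨y, hy0, hy, hmax⟩ := exists_max_klCoeff p hne
    rw [← hy] at hy0
    apply hy0
    by_cases hyi : cs.IsLeftDescent y i
    · refine IsNegPart.eq_zero_of_invert ?_ (by rw [hy, invert_klBasis_repr p hbar])
      have hnd := (cs.isLeftDescent_iff_not_isLeftDescent_mul).1 hyi
      have h1 := (klCoeff_simple_mul p i hnd (klElt p z)).2
      rw [cs.simple_mul_simple_cancel_left] at h1
      have h2 : klCoeff p y d = klCoeff p (cs.simple i * y) (klElt p z)
          + -(tp (-(p.c i : ℤ)) * klCoeff p y (klElt p z)) := by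
        rw [hd, map_sub, map_smul, map_smul, h1, smul_eq_mul, smul_eq_mul, q_eq]
        linear_combination (klCoeff p (cs.simple i * y) (klElt p z)
          + tp (p.c i) * klCoeff p y (klElt p z)) * hcc
      rw [h2]
      refine IsNegPart.add ((klElt_spec p z).2.2 _ fun h => hnd (h ▸ hz)) (IsNegPart.neg ?_)
      -- The diagonal term is `t^{-c_s}`; it has negative degree because `c_s > 0`.
      by_cases hyz : y = z
      · rw [hyz, (klElt_spec p z).2.1, mul_one]
        exact isNegPart_tp (by omega)
      · exact ((klElt_spec p z).2.2 _ hyz).tp_mul (by omega)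
    · have h1 := (klCoeff_simple_mul p i hyi d).1
      rw [hTd, hmax _ (by have := (cs.not_isLeftDescent_iff).1 hyi; omega), mul_zero, map_neg,
        neg_eq_zero] at h1
      exact h1
  have h3 : tp (p.c i) • d = 0 := by rw [hd0, smul_zero]
  rw [hd, smul_sub, smul_smul, smul_smul, mul_comm (tp (p.c i : ℤ)) (tp (-(p.c i : ℤ))), hcc,
    one_smul, ← q_eq, sub_eq_zero] at h3
  exact h3

/-- At a leading term `y` with `sy > y`, the eigenvalue equation expresses the coefficient through
the one at `sy`, which vanishes by maximality. -/
theorem eq_zero_of_simple_mul_eq {i : B} {h : Hecke p}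
    (hT : heckeT p (cs.simple i) * h = p.q i • h)
    (hs : ∀ y, (klBasis p).repr h y ≠ 0 → ¬ cs.IsLeftDescent y i) : h = 0 := by
  by_contra hne
  obtain ⟨y, hy0, hy, hmax⟩ := exists_max_klCoeff p hne
  have hyi := hs y hy0
  have h1 := (klCoeff_simple_mul p i hyi h).1
  rw [hT, hmax _ (by have := (cs.not_isLeftDescent_iff).1 hyi; omega), mul_zero, map_smul,
    smul_eq_mul, HeckeParam.q] at h1
  exact hy0 (hy ▸ tp_mul_eq_zero h1)

/-- The element `(T_s + 1)x` is a `q_s`-eigenvector of `T_s`, and so is its part `b` on the `C'_y`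
with `sy < y`. The difference is an eigenvector supported on the `y` with `sy > y`, hence zero, so
`(T_s + 1)x` has no coordinates there. No explicit multiplication formula with its correction terms
is needed. -/
theorem klBasis_repr_simple_mul (i : B) {y : W} (hy : ¬ cs.IsLeftDescent y i) (x : Hecke p) :
    (klBasis p).repr (heckeT p (cs.simple i) * x) y = -(klBasis p).repr x y := by
  classical
  set h := heckeT p (cs.simple i) * x + x with hh
  have hT : heckeT p (cs.simple i) * h = p.q i • h := by
    rw [hh, mul_add, heckeT_simple_mul_self_mul]; module
  set a := (klBasis p).repr h with ha
  set b := Finsupp.linearCombination ZT (klElt p) (a.filter fun y => cs.IsLeftDescent y i) with hb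
  have hbT : heckeT p (cs.simple i) * b = p.q i • b := by
    rw [hb, Finsupp.linearCombination_apply, Finsupp.sum, Finset.mul_sum, Finset.smul_sum]
    refine Finset.sum_congr rfl fun y hy => ?_
    rw [Finsupp.support_filter, Finset.mem_filter] at hy
    rw [mul_smul_comm, heckeT_simple_mul_klElt p hy.2, smul_comm]
  have hrb : (klBasis p).repr b = a.filter fun y => cs.IsLeftDescent y i := by
    rw [hb, show klElt p = klBasis p from funext fun y => (klBasis_apply p y).symm]
    exact (klBasis p).repr_linearCombination _
  have h0 : h - b = 0 := by
    refine eq_zero_of_simple_mul_eq p (i := i) (by rw [mul_sub, hT, hbT, smul_sub]) fun y hy => ?_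
    intro hyi
    apply hy
    rw [map_sub, Finsupp.sub_apply, hrb, Finsupp.filter_apply_pos (fun y => cs.IsLeftDescent y i) _ hyi, ← ha, sub_self]
  have h1 : a y = 0 := by
    rw [ha, sub_eq_zero.1 h0, hrb, Finsupp.filter_apply_neg (fun y => cs.IsLeftDescent y i) _ hy]
  rw [ha, hh, map_add, Finsupp.add_apply] at h1
  exact eq_neg_of_add_eq_zero_left h1

end KLDescent
-- Kazhdan–Lusztig basis of the left cell module.
section CellBasis

variable {B W : Type*} [Group W] {M : CoxeterMatrix B} {cs : CoxeterSystem M W}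
  (p : HeckeParam cs)

theorem mem_klIdeal_iff {I : Set W} {hI : ∀ z y, LeL p z y → y ∈ I → z ∈ I} {x : Hecke p} :
    x ∈ klIdeal p I hI ↔ ∀ y, (klBasis p).repr x y ≠ 0 → y ∈ I := by
  have h : klElt p = klBasis p := funext fun y => (klBasis_apply p y).symm
  change x ∈ Submodule.span ZT (klElt p '' I) ↔ _
  rw [h, Module.Basis.mem_span_image]
  exact ⟨fun h y hy => h (Finset.mem_coe.2 (Finsupp.mem_support_iff.2 hy)),
    fun h y hy => h y (Finsupp.mem_support_iff.1 (Finset.mem_coe.1 hy))⟩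

theorem klBasis_repr_klElt (w : W) : (klBasis p).repr (klElt p w) = Finsupp.single w 1 := by
  rw [← klBasis_apply, Module.Basis.repr_self]

variable {p} in
theorem IsLeftCell.leL {ω : Set W} (hω : IsLeftCell p ω) {y w : W} (hy : y ∈ ω) (hw : w ∈ ω) :
    LeL p y w := by
  obtain ⟨v, rfl⟩ := hω
  exact hy.1.trans hw.2

variable {p} in
theorem IsLeftCell.mem {ω : Set W} (hω : IsLeftCell p ω) {y w : W} (hw : w ∈ ω)
    (h1 : LeL p y w) (h2 : LeL p w y) : y ∈ ω := by
  obtain ⟨v, rfl⟩ := hω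
  exact ⟨h1.trans hw.1, hw.2.trans h2⟩

/-- The element `C'_y` of `H^{≤_L ω}`, for `y ∈ ω`. -/
noncomputable def cellElt (ω : Set W) (y : ω) : idealLE p ω :=
  ⟨klElt p y, (mem_klIdeal_iff p).2 fun z hz => by
    classical
    rw [klBasis_repr_klElt, Finsupp.single_apply] at hz
    exact ⟨y, y.2, (of_not_not fun h => hz (if_neg h)) ▸ Relation.ReflTransGen.refl⟩⟩

/-- The projection of `H^{≤_L ω}` onto the left cell module, as a `ℤ[t, t⁻¹]`-linear map. -/
noncomputable def cellMk (ω : Set W) : idealLE p ω →ₗ[ZT] cellModule p ω :=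
  ((idealLT p ω).submoduleOf (idealLE p ω)).mkQ.restrictScalars ZT

theorem cellMk_surjective (ω : Set W) : Function.Surjective (cellMk p ω) :=
  Submodule.mkQ_surjective ((idealLT p ω).submoduleOf (idealLE p ω))

theorem cellMk_eq_zero_iff {ω : Set W} (x : idealLE p ω) :
    cellMk p ω x = 0 ↔ (x : Hecke p) ∈ idealLT p ω :=
  (Submodule.Quotient.mk_eq_zero _).trans Iff.rfl

theorem smul_cellMk (ω : Set W) (h : Hecke p) (x : idealLE p ω) :
    h • cellMk p ω x = cellMk p ω (h • x) := rfl

/-- The classes span: an element that is `≤_L ω` but not in `ω` is strictly below `ω`, so its `C'_z`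
dies in the quotient. -/
theorem cellMk_eq_sum {ω : Set W} (hω : IsLeftCell p ω) [Fintype ω] (x : idealLE p ω) :
    cellMk p ω x = ∑ y : ω, (klBasis p).repr (x : Hecke p) y • cellMk p ω (cellElt p ω y) := by
  classical
  rw [← sub_eq_zero]
  simp only [← map_smul, ← map_sum, ← map_sub]
  rw [cellMk_eq_zero_iff]
  refine (mem_klIdeal_iff p).2 fun z hz => ?_
  have hc : ((x - ∑ y : ω, (klBasis p).repr (x : Hecke p) y • cellElt p ω y : idealLE p ω) :
      Hecke p) = (x : Hecke p) - ∑ y : ω, (klBasis p).repr (x : Hecke p) y • klElt p y := by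
    rw [Submodule.coe_sub, Submodule.coe_sum]
    rfl
  rw [hc] at hz
  simp only [map_sub, map_sum, map_smul, klBasis_repr_klElt, Finsupp.sub_apply,
    Finsupp.coe_finsetSum, Finset.sum_apply, Finsupp.smul_apply, Finsupp.single_apply,
    smul_eq_mul, mul_ite, mul_one, mul_zero] at hz
  by_cases hzω : z ∈ ω
  · exfalso
    apply hz
    rw [Finset.sum_eq_single (⟨z, hzω⟩ : ω), if_pos rfl, sub_self]
    · intro b _ hb
      exact if_neg fun h => hb (Subtype.ext h)
    · intro h; exact absurd (Finset.mem_univ _) h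
  · rw [Finset.sum_eq_zero fun y _ => if_neg fun h => hzω (by rw [← h]; exact y.2),
      sub_zero] at hz
    obtain ⟨w, hw, hzw⟩ := (mem_klIdeal_iff p).1 x.2 z hz
    exact ⟨w, hw, hzw, fun h => hzω (hω.mem hw hzw h)⟩

/-- No element of `ω` is strictly below another, so a nontrivial combination of the `C'_y`, `y ∈ ω`,
is never in `H^{<_L ω}`. -/
theorem linearIndependent_cellElt {ω : Set W} (hω : IsLeftCell p ω) :
    LinearIndependent ZT fun y : ω => cellMk p ω (cellElt p ω y) := by
  classical
  rw [linearIndependent_iff']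
  intro s g hg i hi
  simp only [← map_smul, ← map_sum] at hg
  rw [cellMk_eq_zero_iff] at hg
  by_contra hne
  obtain ⟨w, hw, h1, h2⟩ := (mem_klIdeal_iff p).1 hg i (by
    have hc : ((∑ y ∈ s, g y • cellElt p ω y : idealLE p ω) : Hecke p) =
        ∑ y ∈ s, g y • klElt p y := by
      rw [Submodule.coe_sum]; rfl
    rw [hc]
    simp only [map_sum, map_smul, klBasis_repr_klElt, Finsupp.coe_finsetSum, Finset.sum_apply,
      Finsupp.smul_apply, Finsupp.single_apply, smul_eq_mul, mul_ite, mul_one, mul_zero]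
    rw [Finset.sum_eq_single i, if_pos rfl]
    · exact hne
    · intro b _ hb
      exact if_neg fun h => hb (Subtype.ext h)
    · intro h; exact absurd hi h)
  exact h2 (hω.leL hw i.2)

variable [Finite W] {ω : Set W} (hω : IsLeftCell p ω)

/-- The basis of the left cell module consisting of the classes of the `C'_y`, `y ∈ ω`. -/
noncomputable def cellBasis : Module.Basis ω ZT (cellModule p ω) :=
  Module.Basis.mk (linearIndependent_cellElt p hω) (by
    let := Fintype.ofFinite ω
    rintro x -
    obtain ⟨x, rfl⟩ := cellMk_surjective p ω x
    rw [cellMk_eq_sum p hω x]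
    exact Submodule.sum_mem _ fun y _ =>
      Submodule.smul_mem _ _ (Submodule.subset_span ⟨y, rfl⟩))

theorem cellBasis_apply (y : ω) : cellBasis p hω y = cellMk p ω (cellElt p ω y) :=
  Module.Basis.mk_apply _ _ _

theorem cellBasis_repr (x : idealLE p ω) (y : ω) :
    (cellBasis p hω).repr (cellMk p ω x) y = (klBasis p).repr (x : Hecke p) y := by
  classical
  let := Fintype.ofFinite ω
  rw [cellMk_eq_sum p hω x]
  simp only [← cellBasis_apply p hω, map_sum, map_smul, Module.Basis.repr_self,
    Finsupp.coe_finsetSum, Finset.sum_apply, Finsupp.smul_apply, Finsupp.single_apply, smul_eq_mul,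
    mul_ite, mul_one, mul_zero, Finset.sum_ite_eq', Finset.mem_univ, if_true]

theorem simple_smul_cellBasis {i : B} {y : ω} (hy : cs.IsLeftDescent (y : W) i) :
    heckeT p (cs.simple i) • cellBasis p hω y = p.q i • cellBasis p hω y := by
  rw [cellBasis_apply, smul_cellMk, ← map_smul]
  congr 1
  exact Subtype.ext (heckeT_simple_mul_klElt p hy)

theorem cellBasis_repr_simple_smul {i : B} {y : ω} (hy : ¬ cs.IsLeftDescent (y : W) i)
    (x : cellModule p ω) :
    (cellBasis p hω).repr (heckeT p (cs.simple i) • x) y = -(cellBasis p hω).repr x y := by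
  obtain ⟨x, rfl⟩ := cellMk_surjective p ω x
  rw [smul_cellMk, cellBasis_repr, cellBasis_repr]
  exact klBasis_repr_simple_mul p i hy x

end CellBasis

/-! ### Right action of `T_s` on the dual left cell module. -/

section DualCell

open TensorProduct MulOpposite

variable (R : Type*) [CommRing R] [Algebra ZT R]
variable {B W : Type*} [Group W] {M : CoxeterMatrix B} {cs : CoxeterSystem M W}
  (p : HeckeParam cs)

/-- The standard generator `T_w` of `H_R`. -/
noncomputable def heckeOverT (w : W) : HeckeOver R p := (1 : R) ⊗ₜ[ZT] heckeT p w

noncomputable instance (ω : Set W) : Module R (DualCell R p ω) :=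
  inferInstanceAs (Module R (Module.Dual R (R ⊗[ZT] cellModule p ω)))

theorem dualCell_smul_apply (ω : Set W) (a : (HeckeOver R p)ᵐᵒᵖ) (f : DualCell R p ω)
    (x : R ⊗[ZT] cellModule p ω) :
    (show Module.Dual R (R ⊗[ZT] cellModule p ω) from a • f) x =
      (show Module.Dual R (R ⊗[ZT] cellModule p ω) from f) (cellAction R p ω a.unop x) := rfl

instance (ω : Set W) : IsScalarTower R (HeckeOver R p)ᵐᵒᵖ (DualCell R p ω) where
  smul_assoc r a f := by
    refine LinearMap.ext (f := (show Module.Dual R (R ⊗[ZT] cellModule p ω) from (r • a) • f))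
      fun x => ?_
    rw [dualCell_smul_apply, unop_smul, map_smul, LinearMap.smul_apply, map_smul]
    rfl

variable [Finite W] {ω : Set W} (hω : IsLeftCell p ω)

/-- The basis of the dual left cell module dual to the basis of the `C'_y`, `y ∈ ω`. -/
noncomputable def dualCellBasis : Module.Basis ω R (DualCell R p ω) :=
  haveI := Classical.decEq ω
  ((cellBasis p hω).baseChange R).dualBasis

theorem dualCellBasis_repr (f : DualCell R p ω) (y : ω) : (dualCellBasis R p hω).repr f y =
    (show Module.Dual R (R ⊗[ZT] cellModule p ω) from f) (1 ⊗ₜ cellBasis p hω y) := by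
  let := Classical.decEq ω
  rw [← Module.Basis.baseChange_apply]
  exact Module.Basis.dualBasis_repr _ _ _

theorem dualCellBasis_apply (y : ω) (r : R) (x : cellModule p ω) :
    (show Module.Dual R (R ⊗[ZT] cellModule p ω) from dualCellBasis R p hω y) (r ⊗ₜ x) =
      (cellBasis p hω).repr x y • r := by
  let := Classical.decEq ω
  rw [← Module.Basis.baseChange_repr_tmul]
  exact Module.Basis.dualBasis_apply _ _ _

/-- Transpose of `cellBasis_repr_simple_smul`: row `y` of the matrix of `T_s` is minus the unit row.
-/
theorem simple_smul_dualCellBasis {i : B} {y : ω} (hy : ¬ cs.IsLeftDescent (y : W) i) :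
    op (heckeOverT R p (cs.simple i)) • dualCellBasis R p hω y = -dualCellBasis R p hω y := by
  refine (dualCellBasis R p hω).repr.injective (Finsupp.ext fun z => ?_)
  rw [map_neg, Finsupp.neg_apply, dualCellBasis_repr, dualCellBasis_repr, dualCell_smul_apply,
    unop_op, heckeOverT, cellAction_tmul, mul_one, dualCellBasis_apply, dualCellBasis_apply,
    cellBasis_repr_simple_smul p hω hy, neg_smul]

/-- Transpose of `simple_smul_cellBasis`. Consequently `f T_s - q_s f` has coordinates only at those
`y` with `sy > y`. -/
theorem dualCellBasis_repr_simple_smul {i : B} {y : ω} (hy : cs.IsLeftDescent (y : W) i)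
    (f : DualCell R p ω) :
    (dualCellBasis R p hω).repr (op (heckeOverT R p (cs.simple i)) • f) y =
      algebraMap ZT R (p.q i) * (dualCellBasis R p hω).repr f y := by
  rw [dualCellBasis_repr, dualCellBasis_repr, dualCell_smul_apply, unop_op, heckeOverT,
    cellAction_tmul, mul_one, simple_smul_cellBasis p hω hy, ← smul_tmul,
    Algebra.smul_def, mul_one, ← smul_eq_mul, ← map_smul, smul_tmul', smul_eq_mul, mul_one]

end DualCell
-- Trace form over `R`, the ideal `x_J H_R` and Frobenius reciprocity.
section HeckeOver

open TensorProduct MulOpposite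

variable {B W : Type*} [Group W] {M : CoxeterMatrix B} {cs : CoxeterSystem M W}
  (p : HeckeParam cs)

theorem heckeT_simple_mul_eq_smul {i : B} {h : Hecke p}
    (hh : ∀ w, (heckeBasis p).repr h (cs.simple i * w) = (heckeBasis p).repr h w) :
    heckeT p (cs.simple i) * h = p.q i • h := by
  refine (heckeBasis p).repr.injective (Finsupp.ext fun w => ?_)
  rw [map_smul, Finsupp.smul_apply, smul_eq_mul]
  by_cases hw : cs.IsLeftDescent w i
  · have h1 := (heckeT_simple_mul_repr p i
      ((cs.isLeftDescent_iff_not_isLeftDescent_mul).1 hw) h).2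
    rw [cs.simple_mul_simple_cancel_left, hh] at h1
    rw [h1]
    ring
  · rw [(heckeT_simple_mul_repr p i hw h).1, hh]

theorem heckeT_simple_mul_parabolic [Finite W] {J : Set B} {i : B} (hi : i ∈ J) :
    heckeT p (cs.simple i) * ∑ᶠ w ∈ (parabolic cs J : Set W), heckeT p w =
      p.q i • ∑ᶠ w ∈ (parabolic cs J : Set W), heckeT p w := by
  classical
  refine heckeT_simple_mul_eq_smul p fun w => ?_
  have hr : ∀ v, (heckeBasis p).repr (∑ᶠ w ∈ (parabolic cs J : Set W), heckeT p w) v =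
      if v ∈ parabolic cs J then 1 else 0 := by
    intro v
    rw [finsum_mem_eq_finite_toFinset_sum _ (Set.toFinite _), map_sum, Finsupp.coe_finsetSum,
      Finset.sum_apply]
    simp only [← heckeBasis_apply, Module.Basis.repr_self, Finsupp.single_apply]
    rw [Finset.sum_ite_eq']
    simp
  rw [hr, hr]
  congr 1
  exact propext (Subgroup.mul_mem_cancel_left _ (Subgroup.subset_closure ⟨i, hi, rfl⟩))

variable (R : Type*) [CommRing R] [Algebra ZT R]

/-- The basis `(T_w)` of `H_R`. -/
noncomputable def heckeOverBasis : Module.Basis W R (HeckeOver R p) := (heckeBasis p).baseChange R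

theorem heckeOverBasis_apply (w : W) : heckeOverBasis p R w = heckeOverT R p w := by
  rw [heckeOverBasis, Module.Basis.baseChange_apply, heckeBasis_apply, heckeOverT]

/-- The symmetrizing trace on `H_R`: the coefficient at `T_1`. -/
noncomputable def traceOver : HeckeOver R p →ₗ[R] R := (heckeOverBasis p R).coord 1

theorem traceOver_tmul (r : R) (h : Hecke p) :
    traceOver p R (r ⊗ₜ h) = algebraMap ZT R (heckeTrace p h) * r := by
  rw [traceOver, Module.Basis.coord_apply, heckeOverBasis, Module.Basis.baseChange_repr_tmul,
    Algebra.smul_def]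
  rfl

open scoped Classical in
theorem traceOver_T_mul_T (v w : W) :
    traceOver p R (heckeOverT R p v * heckeOverT R p w) =
      if v * w = 1 then algebraMap ZT R (tp (2 * (p.weight v : ℤ))) else 0 := by
  rw [heckeOverT, heckeOverT, Algebra.TensorProduct.tmul_mul_tmul, traceOver_tmul,
    heckeTrace_T_mul_T, mul_one, mul_one]
  split_ifs <;> simp

/-- On basis elements this is the symmetry `L(v) = L(v⁻¹)`. -/
theorem traceOver_mul_comm (x y : HeckeOver R p) :
    traceOver p R (x * y) = traceOver p R (y * x) := by
  classical
  have h : (LinearMap.mul R (HeckeOver R p)).compr₂ (traceOver p R) =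
      ((LinearMap.mul R (HeckeOver R p)).compr₂ (traceOver p R)).flip := by
    refine (heckeOverBasis p R).ext fun v => (heckeOverBasis p R).ext fun w => ?_
    simp only [LinearMap.compr₂_apply, LinearMap.flip_apply, LinearMap.mul_apply',
      heckeOverBasis_apply, traceOver_T_mul_T]
    by_cases hvw : v * w = 1
    · have hw : w = v⁻¹ := eq_inv_of_mul_eq_one_right hvw
      rw [if_pos hvw, if_pos (by rw [hw, inv_mul_cancel]), hw, p.weight_inv]
    · rw [if_neg hvw, if_neg fun h => hvw (mul_eq_one_comm.1 h)]
  exact LinearMap.congr_fun₂ h x y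

theorem heckeOverT_simple_mul_xElt [Finite W] {J : Set B} {i : B} (hi : i ∈ J) :
    heckeOverT R p (cs.simple i) * xElt R p J = algebraMap ZT R (p.q i) • xElt R p J := by
  rw [xElt, heckeOverT, Algebra.TensorProduct.tmul_mul_tmul, mul_one,
    heckeT_simple_mul_parabolic p hi, ← smul_tmul, smul_tmul', Algebra.smul_def, mul_one,
    smul_eq_mul, mul_one]

theorem mem_xIdeal_iff {J : Set B} {y : HeckeOver R p} :
    y ∈ xIdeal R p J ↔ ∃ h, y = xElt R p J * h := by
  rw [xIdeal, Submodule.mem_span_singleton]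
  exact ⟨fun ⟨a, h⟩ => ⟨a.unop, h.symm⟩, fun ⟨a, h⟩ => ⟨op a, h.symm⟩⟩

/-- The easy direction of Frobenius reciprocity: cyclicity of the trace brings `T_s` to the left of
`x_J`, where it acts by `q_s`. -/
theorem traceOver_mul_simple [Finite W] {J : Set B} {i : B} (hi : i ∈ J) {y : HeckeOver R p}
    (hy : y ∈ xIdeal R p J) : traceOver p R (y * heckeOverT R p (cs.simple i)) =
      algebraMap ZT R (p.q i) * traceOver p R y := by
  obtain ⟨h, rfl⟩ := (mem_xIdeal_iff p R).1 hy
  rw [traceOver_mul_comm, ← mul_assoc, heckeOverT_simple_mul_xElt p R hi, smul_mul_assoc, map_smul,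
    smul_eq_mul]

theorem algebraMap_tp_neg_mul (k : ℤ) :
    algebraMap ZT R (tp (-k)) * algebraMap ZT R (tp k) = 1 := by
  rw [← map_mul, tp_neg_mul_tp, map_one]

/-- Pairing with `T_{w⁻¹}` recovers the coefficient at `T_w` up to the unit `t^{2L(w)}`. -/
theorem traceOver_nondegenerate [Finite W] {x y : HeckeOver R p}
    (h : ∀ z, traceOver p R (x * z) = traceOver p R (y * z)) : x = y := by
  classical
  let := Fintype.ofFinite W
  have key : ∀ x : HeckeOver R p, ∀ w, traceOver p R (x * heckeOverT R p w⁻¹) =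
      (heckeOverBasis p R).repr x w * algebraMap ZT R (tp (2 * (p.weight w : ℤ))) := by
    intro x w
    conv_lhs => rw [← (heckeOverBasis p R).sum_repr x]
    rw [Finset.sum_mul, map_sum, Finset.sum_eq_single w]
    · rw [smul_mul_assoc, map_smul, heckeOverBasis_apply, traceOver_T_mul_T,
        if_pos (mul_inv_cancel w), smul_eq_mul]
    · intro v _ hv
      rw [smul_mul_assoc, map_smul, heckeOverBasis_apply, traceOver_T_mul_T,
        if_neg fun h => hv (mul_inv_eq_one.1 h), smul_zero]
    · intro h; exact absurd (Finset.mem_univ _) h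
  refine (heckeOverBasis p R).repr.injective (Finsupp.ext fun w => ?_)
  have h1 := h (heckeOverT R p w⁻¹)
  rw [key, key] at h1
  have h2 := congrArg (fun z => z * algebraMap ZT R (tp (-(2 * (p.weight w : ℤ))))) h1
  simpa only [mul_assoc, mul_comm (algebraMap ZT R (tp (2 * (p.weight w : ℤ)))),
    algebraMap_tp_neg_mul, mul_one] using h2

theorem heckeOverT_mul_of_length_add {v w : W}
    (h : cs.length (v * w) = cs.length v + cs.length w) :
    heckeOverT R p v * heckeOverT R p w = heckeOverT R p (v * w) := by
  rw [heckeOverT, heckeOverT, Algebra.TensorProduct.tmul_mul_tmul, mul_one,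
    heckeT_mul_of_length_add p h, heckeOverT]

theorem xElt_mul_T [Fintype W] {J : Set B} [Fintype (parabolic cs J)] {d : W}
    (hd : ∀ u ∈ parabolic cs J, cs.length d ≤ cs.length (u * d)) :
    xElt R p J * heckeOverT R p d = ∑ u : parabolic cs J, heckeOverT R p ((u : W) * d) := by
  have h : xElt R p J = ∑ u : parabolic cs J, heckeOverT R p (u : W) := by
    rw [xElt, ← finsum_set_coe_eq_finsum_mem, finsum_eq_sum_of_fintype, tmul_sum]
    rfl
  rw [h, Finset.sum_mul]
  exact Finset.sum_congr rfl fun u _ =>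
    heckeOverT_mul_of_length_add p R (length_parabolic_mul cs hd u.2)

/-- The coefficients are constant on the cosets `W_J d`, and with `d` of minimal length each coset
sum is `x_J T_d`. -/
theorem sum_smul_mem_xIdeal [Fintype W] {J : Set B} (a : W → R)
    (ha : ∀ i ∈ J, ∀ w, a (cs.simple i * w) = a w) :
    ∑ w, a w • heckeOverT R p w ∈ xIdeal R p J := by
  classical
  have ha' : ∀ u ∈ parabolic cs J, ∀ w, a (u * w) = a w := by
    intro u hu
    induction hu using Subgroup.closure_induction with
    | mem x hx => obtain ⟨i, hi, rfl⟩ := hx; exact ha i hi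
    | one => intro w; rw [one_mul]
    | mul x y _ _ hx hy => intro w; rw [mul_assoc, hx, hy]
    | inv x _ hx => intro w; rw [← hx, mul_inv_cancel_left]
  let Q := Quotient (QuotientGroup.rightRel (parabolic cs J))
  rw [← Finset.sum_fiberwise Finset.univ (fun w => (Quotient.mk _ w : Q))]
  refine Submodule.sum_mem _ fun q _ => ?_
  obtain ⟨d, hdq, hd⟩ : ∃ d : W, (Quotient.mk _ d : Q) = q ∧
      ∀ u ∈ parabolic cs J, cs.length d ≤ cs.length (u * d) := by
    obtain ⟨v, hv⟩ := Quotient.exists_rep q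
    obtain ⟨d, hd, hmin⟩ := Finset.exists_min_image
      (Finset.univ.filter fun w => (Quotient.mk _ w : Q) = q) cs.length ⟨v, by simp [hv]⟩
    have hdq := (Finset.mem_filter.1 hd).2
    refine ⟨d, hdq, fun u hu => hmin _ (Finset.mem_filter.2 ⟨Finset.mem_univ _, ?_⟩)⟩
    rw [← hdq]
    refine Quotient.sound (QuotientGroup.rightRel_apply.2 ?_)
    rw [mul_inv_rev, mul_inv_cancel_left]
    exact inv_mem hu
  refine (mem_xIdeal_iff p R).2 ⟨a d • heckeOverT R p d, ?_⟩
  rw [mul_smul_comm, xElt_mul_T p R hd, Finset.smul_sum]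
  symm
  refine Finset.sum_bij (fun u _ => (u : W) * d) ?_ ?_ ?_ ?_
  · intro u _
    refine Finset.mem_filter.2 ⟨Finset.mem_univ _, ?_⟩
    rw [← hdq]
    refine Quotient.sound (QuotientGroup.rightRel_apply.2 ?_)
    rw [mul_inv_rev, mul_inv_cancel_left]
    exact inv_mem u.2
  · intro u _ v _ huv
    exact Subtype.ext (mul_right_cancel huv)
  · intro w hw
    have hw' := (Finset.mem_filter.1 hw).2
    rw [← hdq] at hw'
    have := QuotientGroup.rightRel_apply.1 (Quotient.exact hw'.symm)
    exact ⟨⟨w * d⁻¹, this⟩, Finset.mem_univ _, inv_mul_cancel_right _ _⟩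
  · intro u _
    rw [ha' u u.2]

/-- Frobenius reciprocity: a linear form on which `T_s`, `s ∈ J`, acts through the index
character gives a homomorphism into `x_J H_R`. -/
theorem exists_hom_xIdeal [Finite W] {J : Set B} {E : Type*} [AddCommGroup E] [Module R E]
    [Module (HeckeOver R p)ᵐᵒᵖ E] [IsScalarTower R (HeckeOver R p)ᵐᵒᵖ E] (φ : E →ₗ[R] R)
    (hφ : ∀ i ∈ J, ∀ e, φ (op (heckeOverT R p (cs.simple i)) • e) =
      algebraMap ZT R (p.q i) * φ e) :
    ∃ ρ : E →ₗ[(HeckeOver R p)ᵐᵒᵖ] xIdeal R p J,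
      ∀ e h, traceOver p R ((ρ e : HeckeOver R p) * h) = φ (op h • e) := by
  classical
  let := Fintype.ofFinite W
  -- These coefficients are forced: `τ(ρ(e) T_{w⁻¹})` must equal `φ(e T_{w⁻¹})`, and the power of
  -- `t` normalizes the dual basis.
  let a : E → W → R := fun e w =>
    algebraMap ZT R (tp (-(2 * (p.weight w : ℤ)))) * φ (op (heckeOverT R p w⁻¹) • e)
  let ρ : E → HeckeOver R p := fun e => ∑ w, a e w • heckeOverT R p w
  have hρ : ∀ e h, traceOver p R (ρ e * h) = φ (op h • e) := by
    intro e h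
    let ψ : HeckeOver R p →ₗ[R] R :=
      { toFun := fun h => φ (op h • e)
        map_add' := fun x y => by rw [op_add, add_smul, map_add]
        map_smul' := fun r x => by rw [op_smul, smul_assoc, map_smul]; rfl }
    have : (traceOver p R).comp (LinearMap.mulLeft R (ρ e)) = ψ := by
      refine (heckeOverBasis p R).ext fun v => ?_
      rw [LinearMap.comp_apply, LinearMap.mulLeft_apply, heckeOverBasis_apply, Finset.sum_mul,
        map_sum, Finset.sum_eq_single v⁻¹]
      · rw [smul_mul_assoc, map_smul, traceOver_T_mul_T, if_pos (inv_mul_cancel v), smul_eq_mul,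
          mul_right_comm, algebraMap_tp_neg_mul, one_mul, inv_inv]
        rfl
      · intro w _ hw
        rw [smul_mul_assoc, map_smul, traceOver_T_mul_T,
          if_neg fun h => hw (eq_inv_of_mul_eq_one_left h), smul_zero]
      · intro h; exact absurd (Finset.mem_univ _) h
    exact LinearMap.congr_fun this h
  -- Passing from `w` to `sw` multiplies the value of `φ` by `q_s` and the normalizing factor by
  -- `q_s⁻¹`, so the coefficients are `W_J`-invariant and `ρ(e)` lands in `x_J H_R`.
  have hstep : ∀ i ∈ J, ∀ e w, ¬ cs.IsLeftDescent w i → a e (cs.simple i * w) = a e w := by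
    intro i hi e w hw
    have hl := (cs.not_isLeftDescent_iff).1 hw
    have e1 : heckeOverT R p (cs.simple i * w)⁻¹ =
        heckeOverT R p w⁻¹ * heckeOverT R p (cs.simple i) := by
      rw [heckeOverT_mul_of_length_add, mul_inv_rev, cs.inv_simple]
      rw [← cs.inv_simple, ← mul_inv_rev, cs.length_inv, cs.length_inv, cs.length_inv,
        cs.length_simple, hl]
    have e2 : tp (-(2 * (p.weight (cs.simple i * w) : ℤ))) * p.q i =
        tp (-(2 * (p.weight w : ℤ))) := by
      rw [p.weight_simple_mul hw, HeckeParam.q, ← LaurentPolynomial.T_add]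
      congr 1
      push_cast; ring
    simp only [a]
    rw [e1, op_mul, mul_smul, hφ i hi, ← mul_assoc, ← map_mul, e2]
  have hmem : ∀ e, ρ e ∈ xIdeal R p J := fun e => by
    refine sum_smul_mem_xIdeal p R _ fun i hi w => ?_
    by_cases hw : cs.IsLeftDescent w i
    · have := hstep i hi e _ ((cs.isLeftDescent_iff_not_isLeftDescent_mul).1 hw)
      rw [cs.simple_mul_simple_cancel_left] at this
      exact this.symm
    · exact hstep i hi e w hw
  -- Additivity and `H_R`-linearity follow from nondegeneracy, because all values `τ(ρ(e)h)` are
  -- known.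
  refine ⟨{ toFun := fun e => ⟨ρ e, hmem e⟩, map_add' := fun x y => ?_,
            map_smul' := fun b x => ?_ }, hρ⟩
  · refine Subtype.ext (traceOver_nondegenerate p R fun z => ?_)
    rw [Submodule.coe_add, add_mul, map_add, hρ, hρ, hρ, smul_add, map_add]
  · refine Subtype.ext (traceOver_nondegenerate p R fun z => ?_)
    change traceOver p R (ρ (b • x) * z) = traceOver p R (ρ x * b.unop * z)
    rw [mul_assoc, hρ, hρ, op_mul, mul_smul, op_unop]

end HeckeOver
-- Semisimplicity over `F`: making a linear form equivariant.
section LinearForms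

open TensorProduct MulOpposite

variable {B W : Type*} [Group W] {M : CoxeterMatrix B} {cs : CoxeterSystem M W}
  (p : HeckeParam cs) (R F : Type*) [CommRing R] [Algebra ZT R]
  [Field F] [Algebra R F] [Algebra ZT F] [IsScalarTower ZT R F]
  (E : Type*) [AddCommGroup E] [Module R E] [Module (HeckeOver R p)ᵐᵒᵖ E]
  [IsScalarTower R (HeckeOver R p)ᵐᵒᵖ E]

/-- The left action `(h φ)(e) = φ (e h)` of `H_F` on the `F`-valued linear forms on a right
`H_R`-module. -/
theorem exists_formAction : ∃ Θ : HeckeOver F p →ₐ[F] Module.End F (E →ₗ[R] F),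
    ∀ (r : F) (h : Hecke p) (φ : E →ₗ[R] F) (e : E),
      Θ (r ⊗ₜ h) φ e = r * φ (op ((1 : R) ⊗ₜ[ZT] h) • e) := by
  let θ : Hecke p →ₐ[ZT] Module.End F (E →ₗ[R] F) :=
    { toFun := fun h =>
        { toFun := fun φ => φ.comp (Algebra.lsmul R R E (op ((1 : R) ⊗ₜ[ZT] h)))
          map_add' := fun _ _ => rfl
          map_smul' := fun _ _ => rfl }
      map_one' := by
        ext φ e
        change φ (op (1 : HeckeOver R p) • e) = φ e
        rw [op_one, one_smul]
      map_mul' := fun x y => by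
        ext φ e
        change φ (op ((1 : R) ⊗ₜ[ZT] (x * y)) • e) =
          φ (op ((1 : R) ⊗ₜ[ZT] y) • op ((1 : R) ⊗ₜ[ZT] x) • e)
        rw [← mul_smul, ← op_mul, Algebra.TensorProduct.tmul_mul_tmul, mul_one]
      map_zero' := by
        ext φ e
        change φ (op ((1 : R) ⊗ₜ[ZT] (0 : Hecke p)) • e) = 0
        rw [tmul_zero, op_zero, zero_smul, map_zero]
      map_add' := fun x y => by
        ext φ e
        change φ (op ((1 : R) ⊗ₜ[ZT] (x + y)) • e) =
          φ (op ((1 : R) ⊗ₜ[ZT] x) • e) + φ (op ((1 : R) ⊗ₜ[ZT] y) • e)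
        rw [tmul_add, op_add, add_smul, map_add]
      commutes' := fun z => by
        ext φ e
        change φ (op ((1 : R) ⊗ₜ[ZT] algebraMap ZT (Hecke p) z) • e) = z • φ e
        rw [Algebra.smul_def z (φ e), Algebra.algebraMap_eq_smul_one, ← smul_tmul, Algebra.smul_def, mul_one,
          ← mul_one (algebraMap ZT R z), ← smul_eq_mul, ← smul_tmul', op_smul, smul_assoc]
        change φ (algebraMap ZT R z • op (1 : HeckeOver R p) • e) = _
        rw [op_one, one_smul, map_smul, IsScalarTower.algebraMap_apply ZT R F, Algebra.smul_def] }
  refine ⟨Algebra.TensorProduct.lift (Algebra.ofId F _) θ fun r _ => Algebra.commutes r _,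
    fun r h φ e => ?_⟩
  exact (LinearMap.congr_fun (LinearMap.congr_fun
    (Algebra.TensorProduct.lift_tmul _ _ _ r h) φ) e).trans rfl

theorem algebraMap_q (i : B) : algebraMap ZT R (p.q i) =
    algebraMap ZT R (LaurentPolynomial.T 2) ^ p.c i := by
  rw [← map_pow, LaurentPolynomial.T_pow, HeckeParam.q, mul_comm]

variable {E}

/-- If `H_F` is semisimple, an `F`-valued linear form on `E` on whose restriction to the submodule
`K` the `T_s`, `s ∈ J`, act through the index character can be modified outside `K` such that they
do so on all of `E`. -/
theorem exists_form_extending (hss : IsSemisimpleRing (HeckeOver F p)) (J : Set B)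
    (K : Submodule (HeckeOver R p)ᵐᵒᵖ E) (φ₀ : E →ₗ[R] F)
    (hφ₀ : ∀ i ∈ J, ∀ e ∈ K, φ₀ (op (heckeOverT R p (cs.simple i)) • e) =
      algebraMap ZT F (p.q i) * φ₀ e) :
    ∃ φ : E →ₗ[R] F, (∀ e ∈ K, φ e = φ₀ e) ∧
      ∀ i ∈ J, ∀ e, φ (op (heckeOverT R p (cs.simple i)) • e) =
        algebraMap ZT F (p.q i) * φ e := by
  obtain ⟨Θ, hΘ⟩ := exists_formAction p R F E
  let : Module (HeckeOver F p) (E →ₗ[R] F) := Module.compHom _ Θ.toRingHom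
  have hsmul : ∀ (r : F) (h : Hecke p) (φ : E →ₗ[R] F) (e : E),
      ((r ⊗ₜ[ZT] h : HeckeOver F p) • φ) e = r * φ (op ((1 : R) ⊗ₜ[ZT] h) • e) := hΘ
  -- `V` consists of the forms vanishing on `K`; it is `H_F`-stable because `K` is a submodule.
  -- Semisimplicity gives it a stable complement `V'`.
  let V : Submodule (HeckeOver F p) (E →ₗ[R] F) :=
    { carrier := {φ | ∀ e ∈ K, φ e = 0}
      add_mem' := fun {a b} ha hb e he => by rw [LinearMap.add_apply, ha e he, hb e he, add_zero]
      zero_mem' := fun _ _ => rfl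
      smul_mem' := fun a φ hφ e he => by
        induction a using TensorProduct.induction_on with
        | zero => rw [zero_smul, LinearMap.zero_apply]
        | tmul r h => rw [hsmul, hφ _ (K.smul_mem _ he), mul_zero]
        | add x y hx hy => rw [add_smul, LinearMap.add_apply, hx, hy, add_zero] }
  obtain ⟨V', hV'⟩ := exists_isCompl V
  have hmem : φ₀ ∈ V ⊔ V' := by rw [hV'.sup_eq_top]; exact Submodule.mem_top
  obtain ⟨v, hv, v', hv', hvv⟩ := Submodule.mem_sup.1 hmem
  have hact : ∀ i (φ : E →ₗ[R] F) (e : E),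
      (((1 : F) ⊗ₜ[ZT] heckeT p (cs.simple i) - algebraMap ZT F (p.q i) ⊗ₜ[ZT] (1 : Hecke p) :
        HeckeOver F p) • φ) e =
      φ (op (heckeOverT R p (cs.simple i)) • e) - algebraMap ZT F (p.q i) * φ e := by
    intro i φ e
    rw [sub_smul, LinearMap.sub_apply, hsmul, hsmul, one_mul]
    congr 2
    change φ (op (1 : HeckeOver R p) • e) = φ e
    rw [op_one, one_smul]
  refine ⟨v', fun e he => by rw [← hvv, LinearMap.add_apply, hv e he, zero_add],
    fun i hi e => ?_⟩
  -- Equivariance for `s` means being killed by `a = T_s - q_s`. Write `φ₀ = v + v'` with `v ∈ V`,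
  -- `v' ∈ V'`. As `φ₀` is equivariant on `K`, `a φ₀ ∈ V`, whence `a v' ∈ V ∩ V' = 0`. So `v'` is
  -- equivariant, and it agrees with `φ₀` on `K`.
  set a : HeckeOver F p :=
    (1 : F) ⊗ₜ[ZT] heckeT p (cs.simple i) - algebraMap ZT F (p.q i) ⊗ₜ[ZT] (1 : Hecke p)
  have hV : a • φ₀ ∈ V := fun e he => by rw [hact, hφ₀ i hi e he, sub_self]
  have h0 : a • v' = 0 := by
    refine Submodule.disjoint_def.1 hV'.disjoint _ ?_ (V'.smul_mem _ hv')
    have := sub_mem hV (V.smul_mem a hv)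
    rwa [← smul_sub, ← hvv, add_sub_cancel_left] at this
  rw [← sub_eq_zero, ← hact, h0, LinearMap.zero_apply]

end LinearForms

/-! ### Extending homomorphisms from the kernel, with control of denominators. -/

section Lifting

open TensorProduct MulOpposite

variable {B W : Type*} [Group W] [Finite W] {M : CoxeterMatrix B} {cs : CoxeterSystem M W}
  (p : HeckeParam cs) (R F : Type*) [CommRing R] [Algebra ZT R]
  [Field F] [Algebra R F] [IsFractionRing R F] [Algebra ZT F] [IsScalarTower ZT R F]
  {E : Type*} [AddCommGroup E] [Module R E] [Module (HeckeOver R p)ᵐᵒᵖ E]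
  [IsScalarTower R (HeckeOver R p)ᵐᵒᵖ E]

theorem exists_extend_to_xIdeal {J : Set B} (hss : IsSemisimpleRing (HeckeOver F p))
    (hinv : ∀ s ∈ J, IsUnit (algebraMap ZT R (LaurentPolynomial.T 2) ^ p.c s + 1))
    {ω : Set W} (hω : IsLeftCell p ω) (π : E →ₗ[(HeckeOver R p)ᵐᵒᵖ] DualCell R p ω)
    (hπ : Function.Surjective π) (α : LinearMap.ker π →ₗ[(HeckeOver R p)ᵐᵒᵖ] xIdeal R p J) :
    ∃ ρ : E →ₗ[(HeckeOver R p)ᵐᵒᵖ] xIdeal R p J, ∀ k : LinearMap.ker π, ρ k = α k := by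
  classical
  let := Fintype.ofFinite ω
  let b := dualCellBasis R p hω
  choose g hg using fun y => hπ (b y)
  -- An `R`-linear section of `π`, available because the dual cell module is free. It is in general
  -- not `H_R`-linear; `κ` is the corresponding `R`-linear retraction of `E` onto the kernel.
  let σ : DualCell R p ω →ₗ[R] E := b.constr R g
  have hσ : ∀ f, π (σ f) = f := by
    have : (π.restrictScalars R).comp σ = LinearMap.id := b.ext fun y => by
      rw [LinearMap.comp_apply, LinearMap.restrictScalars_apply, Module.Basis.constr_basis, hg]
      rfl
    exact LinearMap.congr_fun this
  let κ : E →ₗ[R] LinearMap.ker π :=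
    LinearMap.codRestrict ((LinearMap.ker π).restrictScalars R)
      (LinearMap.id - σ.comp (π.restrictScalars R)) fun e => by
        change π (e - σ (π e)) = 0
        rw [map_sub, hσ, sub_self]
  have hκ : ∀ k : LinearMap.ker π, κ k = k := fun k => Subtype.ext (by
    change (k : E) - σ (π k) = k
    rw [LinearMap.mem_ker.1 k.2, map_zero, sub_zero])
  let φ₀ : E →ₗ[R] R :=
    ((traceOver p R).comp ((xIdeal R p J).subtype.restrictScalars R)).comp
      ((α.restrictScalars R).comp κ)
  have hφ₀ : ∀ k : LinearMap.ker π, φ₀ k = traceOver p R (α k : HeckeOver R p) := fun k => by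
    change traceOver p R (α (κ k) : HeckeOver R p) = _
    rw [hκ]
  clear_value φ₀
  have hinj := IsFractionRing.injective R F
  obtain ⟨φF, hφFK, hφF⟩ := exists_form_extending p R F hss J (LinearMap.ker π)
    ((Algebra.linearMap R F).comp φ₀) fun i hi e he => by
      rw [LinearMap.comp_apply, LinearMap.comp_apply, Algebra.linearMap_apply,
        Algebra.linearMap_apply, IsScalarTower.algebraMap_apply ZT R F, ← map_mul]
      congr 1
      have h1 := hφ₀ (op (heckeOverT R p (cs.simple i)) • ⟨e, he⟩)
      rw [map_smul] at h1
      exact h1.trans ((traceOver_mul_simple p R hi (α ⟨e, he⟩).2).trans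
        (congrArg _ (hφ₀ ⟨e, he⟩).symm))
  -- Both forms agree on the kernel, so their difference factors through `π`; composing with `σ`
  -- produces the factor.
  let χ : DualCell R p ω →ₗ[R] F := ((Algebra.linearMap R F).comp φ₀ - φF).comp σ
  have hχ : ∀ e, χ (π e) = algebraMap R F (φ₀ e) - φF e := by
    intro e
    have hk : σ (π e) - e ∈ LinearMap.ker π := by
      rw [LinearMap.mem_ker, map_sub, hσ, sub_self]
    have := hφFK _ hk
    rw [map_sub, map_sub] at this
    change algebraMap R F (φ₀ (σ (π e))) - φF (σ (π e)) = _
    change _ = algebraMap R F (φ₀ (σ (π e))) - algebraMap R F (φ₀ e) at this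
    linear_combination -this
  -- Integrality of `χ(b_y)` when `sy > y` for some `s ∈ J`. From `b_y T_s = -b_y` and the
  -- equivariance of `φF`, for a lift `g` of `b_y`, `(q_s + 1) χ(b_y) = q_s φ₀(g) - φ₀(g T_s)`, and
  -- `q_s + 1` is a unit of `R`.
  have hint : ∀ y : ω, ∃ c : R, (∃ i ∈ J, ¬ cs.IsLeftDescent (y : W) i) →
      χ (b y) = algebraMap R F c := by
    intro y
    by_cases h : ∃ i ∈ J, ¬ cs.IsLeftDescent (y : W) i
    · obtain ⟨i, hi, hy⟩ := h
      obtain ⟨u, hu⟩ := hinv i hi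
      rw [← algebraMap_q] at hu
      have h1 := hχ (op (heckeOverT R p (cs.simple i)) • g y)
      have h2 := hχ (g y)
      rw [map_smul, hg, simple_smul_dualCellBasis R p hω hy, map_neg, hφF i hi] at h1
      rw [hg] at h2
      refine ⟨↑u⁻¹ * (algebraMap ZT R (p.q i) * φ₀ (g y) -
        φ₀ (op (heckeOverT R p (cs.simple i)) • g y)), fun _ => ?_⟩
      have hu1 : algebraMap R F ↑u⁻¹ * (algebraMap ZT F (p.q i) + 1) = 1 := by
        rw [IsScalarTower.algebraMap_apply ZT R F, ← map_one (algebraMap R F), ← map_add,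
          ← map_mul, ← hu, Units.inv_mul]
      rw [map_mul, map_sub, map_mul, ← IsScalarTower.algebraMap_apply]
      change -χ (b y) = _ at h1
      change χ (b y) = _ at h2
      linear_combination (-χ (b y)) * hu1 - algebraMap R F ↑u⁻¹ * h1 +
        algebraMap R F ↑u⁻¹ * algebraMap ZT F (p.q i) * h2
    -- Here every `s ∈ J` is a left descent of `y`. Such a `b_y` does not occur in any `f T_s - q_s
    -- f` with `s ∈ J`, so any value of `ψ` would do.
    · exact ⟨0, fun h' => absurd h' h⟩
  choose c hc using hint
  let ψ : DualCell R p ω →ₗ[R] R := b.constr R c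
  have hD : ∀ i ∈ J, ∀ f : DualCell R p ω,
      (χ - (Algebra.linearMap R F).comp ψ) (op (heckeOverT R p (cs.simple i)) • f) =
        algebraMap ZT F (p.q i) * (χ - (Algebra.linearMap R F).comp ψ) f := by
    intro i hi f
    rw [IsScalarTower.algebraMap_apply ZT R F, ← Algebra.smul_def, ← map_smul, ← sub_eq_zero,
      ← map_sub]
    set f' := op (heckeOverT R p (cs.simple i)) • f - algebraMap ZT R (p.q i) • f with hf'
    rw [← b.sum_repr f', map_sum]
    -- In each term one factor vanishes: the coordinate at `y` if `sy < y`, and the value of `χ - ψ`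
    -- at `b_y` if `sy > y`.
    refine Finset.sum_eq_zero fun y _ => ?_
    rw [map_smul]
    by_cases hy : cs.IsLeftDescent (y : W) i
    · have e1 : b.repr (op (heckeOverT R p (cs.simple i)) • f) y =
          algebraMap ZT R (p.q i) * b.repr f y := dualCellBasis_repr_simple_smul R p hω hy f
      have e2 : b.repr (algebraMap ZT R (p.q i) • f) y =
          algebraMap ZT R (p.q i) * b.repr f y := by rw [map_smul]; rfl
      rw [hf', map_sub, Finsupp.sub_apply, e1, e2, sub_self, zero_smul]
    · rw [LinearMap.sub_apply, hc y ⟨i, hi, hy⟩, LinearMap.comp_apply,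
        Module.Basis.constr_basis, Algebra.linearMap_apply, sub_self, smul_zero]
  -- Subtracting a form that factors through `π` leaves the restriction to the kernel unchanged.
  -- Equivariance is checked after embedding `R` in `F`, where `φ` is a sum of two equivariant
  -- forms.
  let φ : E →ₗ[R] R := φ₀ - ψ.comp (π.restrictScalars R)
  have hφ : ∀ e, algebraMap R F (φ e) =
      φF e + (χ - (Algebra.linearMap R F).comp ψ) (π e) := by
    intro e
    change algebraMap R F (φ₀ e - ψ (π e)) = φF e + (χ (π e) - algebraMap R F (ψ (π e)))
    rw [hχ, map_sub]
    ring
  obtain ⟨ρ, hρ⟩ := exists_hom_xIdeal p R (J := J) φ fun i hi e => hinj (by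
    rw [map_mul, hφ, hφ, hφF i hi, map_smul, hD i hi, ← IsScalarTower.algebraMap_apply]
    ring)
  refine ⟨ρ, fun k => Subtype.ext (traceOver_nondegenerate p R fun z => ?_)⟩
  rw [hρ]
  have h1 := hφ₀ (op z • k)
  rw [map_smul] at h1
  refine Eq.trans ?_ h1
  change φ₀ (op z • (k : E)) - ψ (π (op z • (k : E))) = φ₀ (op z • (k : E))
  have h2 : π (op z • (k : E)) = 0 := (op z • k).2
  rw [h2, map_zero, sub_zero]

end Lifting

/-! ### From extension of homomorphisms to vanishing of `Ext¹`. -/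

section Ext

open CategoryTheory

universe w u v

/-- For a projective `P` mapping onto `S` with kernel `K`, `Ext¹(P, N) = 0`, so each class in
`Ext¹(S, N)` is the connecting image of some `K → N`. A map that extends to `P` has zero image. -/
theorem subsingleton_ext_one_of_extend {A : Type u} [Ring A]
    [HasExt.{w} (ModuleCat.{max u v} A)] (S N : ModuleCat.{max u v} A)
    (h : ∀ (P : Type max u v) [AddCommGroup P] [Module A P] (π : P →ₗ[A] S),
      Function.Surjective π → ∀ α : LinearMap.ker π →ₗ[A] N,
        ∃ ρ : P →ₗ[A] N, ∀ k : LinearMap.ker π, ρ k = α k) :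
    Subsingleton (Abelian.Ext.{w} S N 1) := by
  let T : ShortComplex (ModuleCat.{max u v} A) :=
    ShortComplex.mk (ModuleCat.ofHom (LinearMap.ker (Projective.π S).hom).subtype)
      (Projective.π S) (by ext x; exact x.2)
  have hπ : Function.Surjective (Projective.π S).hom :=
    (ModuleCat.epi_iff_surjective _).1 inferInstance
  have hT : T.ShortExact :=
    { exact := (ShortComplex.moduleCat_exact_iff T).2 fun x hx => ⟨⟨x, hx⟩, rfl⟩
      mono_f := (ModuleCat.mono_iff_injective _).2 Subtype.val_injective
      epi_g := inferInstanceAs (Epi (Projective.π S)) }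
  have : Projective T.X₂ := inferInstanceAs (Projective (Projective.over S))
  refine subsingleton_of_forall_eq 0 fun x => ?_
  obtain ⟨y, rfl⟩ := Abelian.Ext.contravariant_sequence_exact₃ hT N x
    (Abelian.Ext.eq_zero_of_projective _) (add_comm 1 0)
  obtain ⟨α, rfl⟩ := (Abelian.Ext.mk₀_bijective _ _).2 y
  obtain ⟨ρ, hρ⟩ := h _ (Projective.π S).hom hπ α.hom
  have hα : α = T.f ≫ ModuleCat.ofHom ρ := by
    ext k
    exact (hρ k).symm
  rw [hα, ← Abelian.Ext.mk₀_comp_mk₀]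
  exact hT.extClass_comp_assoc _

end Ext

end HeckeCell

theorem mainTheorem6
    {B W : Type*} [Group W] [Finite W] {M : CoxeterMatrix B} (cs : CoxeterSystem M W)
    (p : HeckeCell.HeckeParam cs)
    (R F : Type*) [CommRing R] [IsDomain R] [Algebra HeckeCell.ZT R]
    [Field F] [Algebra R F] [IsFractionRing R F]
    [Algebra HeckeCell.ZT F] [IsScalarTower HeckeCell.ZT R F]
    (J : Set B)
    (hss : IsSemisimpleRing (HeckeCell.HeckeOver F p))
    (hinv : ∀ s ∈ J, IsUnit (algebraMap HeckeCell.ZT R (LaurentPolynomial.T 2) ^ p.c s + 1))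
    (ω : Set W) (hω : HeckeCell.IsLeftCell p ω) :
    Subsingleton (CategoryTheory.Abelian.Ext
      (ModuleCat.of (HeckeCell.HeckeOver R p)ᵐᵒᵖ (HeckeCell.DualCell R p ω))
      (ModuleCat.of (HeckeCell.HeckeOver R p)ᵐᵒᵖ (HeckeCell.xIdeal R p J)) 1) := by
  refine HeckeCell.subsingleton_ext_one_of_extend _ _ fun P _ _ π hπ α => ?_
  -- `P` comes only with its right `H_R`-module structure; the scalars from `R` act through the
  -- algebra map.
  let : Module R P := Module.compHom P (algebraMap R (HeckeCell.HeckeOver R p)ᵐᵒᵖ)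
  have : IsScalarTower R (HeckeCell.HeckeOver R p)ᵐᵒᵖ P := ⟨fun r a x => by
    rw [Algebra.smul_def, mul_smul]; rfl⟩
  exact HeckeCell.exists_extend_to_xIdeal p R F hss hinv hω π hπ α
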